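/- Let $Q$ be a finite quiver without oriented cycles that has exactly one source $0$ and exactly one sink $\omega$, and in which every other vertex is the source of exactly one arrow and the target of exactly one arrow (a toupie quiver). Let $I$ be an admissible two-sided ideal of the path algebra $\mathbb{C}Q$ (that is, $J^N \subseteq I \subseteq J^2$ for some $N \geq 2$, where $J$ is the ideal generated by the arrows), and let $A = \mathbb{C}Q/I$ (a toupie algebra). Paths are multiplied from left to right, and $e_x \in A$ denotes the idempotent of the vertex $x$. Let - $a$ be the number of arrows from $0$ to $\omega$; - $D = \dim_{\mathbb{C}} e_0 A e_\omega$; - $m$ be the number of branches (paths from $0$ to $\omega$ in $Q$) that contain a monomial relation, i.e. that have a subpath lying in $I$. Let $HH^1(A)$ be the first Hochschild cohomology space of $A$ (Hochschild $1$-cocycles modulo $1$-coboundaries), regarded as a complex Lie algebra with the Gerstenhaber bracket $[f,g] = f\circ g - g\circ f$. Suppose that $HH^1(A)$ is not abelian. Then $HH^1(A)$ is semisimple if and only if $a = D$ and $m = 0$; and in that case $HH^1(A)$ is isomorphic as a Lie algebra to $\mathfrak{sl}_a(\mathbb{C})$. -/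

import Mathlib

noncomputable section

universe u v w

/-! ### The path algebra of a finite quiver -/

/-- The path algebra `kQ` of a quiver `Q` with vertex set `V`: the vector space with basis all paths
(the paths of length `0` included). The product of two paths, read from left to right, is their
concatenation if the first ends where the second starts, and `0` otherwise. -/
def PathAlgebra (k : Type w) [Field k] (V : Type u) [Quiver.{v} V] : Type (max u v w) :=
  (Σ x : V, Σ y : V, Quiver.Path x y) →₀ k

namespace PathAlgebra

variable {k : Type w} [Field k] {V : Type u} [Quiver.{v} V]

instance : AddCommGroup (PathAlgebra k V) :=
  inferInstanceAs (AddCommGroup ((Σ x : V, Σ y : V, Quiver.Path x y) →₀ k))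

instance : Module k (PathAlgebra k V) :=
  inferInstanceAs (Module k ((Σ x : V, Σ y : V, Quiver.Path x y) →₀ k))

/-- The basis of the path algebra formed by the paths. -/
def basis : Module.Basis (Σ x : V, Σ y : V, Quiver.Path x y) k (PathAlgebra k V) :=
  Module.Basis.ofRepr (LinearEquiv.refl k ((Σ x : V, Σ y : V, Quiver.Path x y) →₀ k))

/-- The basis vector of the path algebra given by a path. -/
def ofPath {x y : V} (p : Quiver.Path x y) : PathAlgebra k V := basis ⟨x, y, p⟩

/-- The coefficient of a path in an element of the path algebra. -/
def coeff (f : PathAlgebra k V) {x y : V} (p : Quiver.Path x y) : k := basis.repr f ⟨x, y, p⟩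

open Classical in
/-- The product of two paths in the path algebra. -/
def mulPath (p q : Σ x : V, Σ y : V, Quiver.Path x y) : PathAlgebra k V :=
  if h : p.2.1 = q.1 then ofPath (p.2.2.comp (q.2.2.cast h.symm rfl)) else 0

/-- The multiplication of the path algebra: the bilinear extension of the product of paths. -/
def mulHom : PathAlgebra k V →ₗ[k] PathAlgebra k V →ₗ[k] PathAlgebra k V :=
  basis.constr k fun p => basis.constr k fun q => mulPath p q

instance : Mul (PathAlgebra k V) := ⟨fun f g => mulHom f g⟩

/-- The unit of the path algebra: the sum of the stationary paths. -/
instance [Fintype V] : One (PathAlgebra k V) :=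
  ⟨∑ x : V, ofPath (Quiver.Path.nil : Quiver.Path x x)⟩

theorem mul_def (f g : PathAlgebra k V) : f * g = mulHom f g := rfl

theorem one_def [Fintype V] :
    (1 : PathAlgebra k V) = ∑ x : V, ofPath (Quiver.Path.nil : Quiver.Path x x) := rfl

theorem mulHom_ofPath {x y x' y' : V} (p : Quiver.Path x y) (q : Quiver.Path x' y') :
    mulHom (ofPath p : PathAlgebra k V) (ofPath q) = mulPath ⟨x, y, p⟩ ⟨x', y', q⟩ := by
  simp only [mulHom, ofPath, Module.Basis.constr_basis]

/-- The product of two composable paths is their concatenation. -/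
theorem ofPath_mul_ofPath {x y z : V} (p : Quiver.Path x y) (q : Quiver.Path y z) :
    (ofPath p : PathAlgebra k V) * ofPath q = ofPath (p.comp q) := by
  rw [mul_def, mulHom_ofPath, mulPath, dif_pos rfl]
  rfl

/-- The product of two paths that are not composable is zero. -/
theorem ofPath_mul_ofPath_of_ne {x y x' y' : V} (p : Quiver.Path x y) (q : Quiver.Path x' y')
    (h : y ≠ x') : (ofPath p : PathAlgebra k V) * ofPath q = 0 := by
  rw [mul_def, mulHom_ofPath, mulPath, dif_neg h]

/-- Two linear maps on the path algebra that agree on paths are equal. -/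
theorem linearMap_ext {M : Type*} [AddCommGroup M] [Module k M] {F G : PathAlgebra k V →ₗ[k] M}
    (h : ∀ (x y : V) (p : Quiver.Path x y), F (ofPath p) = G (ofPath p)) : F = G :=
  basis.ext fun ⟨x, y, p⟩ => h x y p

theorem mul_assoc_aux (f g h : PathAlgebra k V) : f * g * h = f * (g * h) := by
  have key : (mulHom (k := k) (V := V)).compr₂ mulHom =
      (LinearMap.llcomp k (PathAlgebra k V) (PathAlgebra k V) (PathAlgebra k V)).compl₂
        mulHom ∘ₗ mulHom := by
    refine linearMap_ext fun x y p => linearMap_ext fun x' y' q => linearMap_ext fun x'' y'' r => ?_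
    change (ofPath p * ofPath q) * ofPath r = (ofPath p : PathAlgebra k V) * (ofPath q * ofPath r)
    have h0 : ∀ f : PathAlgebra k V, 0 * f = 0 := fun f => by rw [mul_def]; simp
    have h0' : ∀ f : PathAlgebra k V, f * 0 = 0 := fun f => by rw [mul_def]; simp
    by_cases h1 : y = x'
    · subst h1
      by_cases h2 : y' = x''
      · subst h2
        simp only [ofPath_mul_ofPath, Quiver.Path.comp_assoc]
      · rw [ofPath_mul_ofPath, ofPath_mul_ofPath_of_ne _ _ h2, ofPath_mul_ofPath_of_ne _ _ h2, h0']
    · rw [ofPath_mul_ofPath_of_ne _ _ h1, h0]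
      by_cases h2 : y' = x''
      · subst h2
        rw [ofPath_mul_ofPath, ofPath_mul_ofPath_of_ne _ _ h1]
      · rw [ofPath_mul_ofPath_of_ne _ _ h2, h0']
  exact LinearMap.congr_fun (LinearMap.congr_fun (LinearMap.congr_fun key f) g) h

theorem one_mul_aux [Fintype V] (f : PathAlgebra k V) : 1 * f = f := by
  have key : mulHom (1 : PathAlgebra k V) = LinearMap.id := by
    refine linearMap_ext fun x y p => ?_
    rw [one_def, map_sum, LinearMap.sum_apply, Finset.sum_eq_single x]
    · rw [← mul_def, ofPath_mul_ofPath, Quiver.Path.nil_comp, LinearMap.id_apply]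
    · intro z _ hz
      rw [← mul_def, ofPath_mul_ofPath_of_ne _ _ hz]
    · simp
  exact LinearMap.congr_fun key f

theorem mul_one_aux [Fintype V] (f : PathAlgebra k V) : f * 1 = f := by
  have key : mulHom.flip (1 : PathAlgebra k V) = LinearMap.id := by
    refine linearMap_ext fun x y p => ?_
    rw [LinearMap.flip_apply, one_def, map_sum, Finset.sum_eq_single y]
    · rw [← mul_def, ofPath_mul_ofPath, Quiver.Path.comp_nil, LinearMap.id_apply]
    · intro z _ hz
      rw [← mul_def, ofPath_mul_ofPath_of_ne _ _ hz.symm]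
    · simp
  exact LinearMap.congr_fun key f

instance [Fintype V] : Ring (PathAlgebra k V) :=
  { (inferInstance : AddCommGroup (PathAlgebra k V)) with
    mul := (· * ·)
    one := 1
    mul_assoc := mul_assoc_aux
    one_mul := one_mul_aux
    mul_one := mul_one_aux
    zero_mul := fun f => by simp [mul_def]
    mul_zero := fun f => by simp [mul_def]
    left_distrib := fun f g h => by simp [mul_def]
    right_distrib := fun f g h => by simp [mul_def] }

instance [Fintype V] : Algebra k (PathAlgebra k V) :=
  Algebra.ofModule (fun c f g => by simp [mul_def]) (fun c f g => by simp [mul_def])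

end PathAlgebra

/-- A two-sided ideal `I` of the path algebra is admissible if `J ^ N ⊆ I ⊆ J ^ 2` for some `N ≥ 2`,
where `J ^ n` is the span of the paths of length at least `n` (`J` is the arrow ideal). -/
def IsAdmissible {k : Type w} [Field k] {V : Type u} [Quiver.{v} V] [Fintype V]
    (I : Ideal (PathAlgebra k V)) : Prop :=
  (∀ f ∈ I, ∀ (x y : V) (p : Quiver.Path x y), f.coeff p ≠ 0 → 2 ≤ p.length) ∧
  ∃ N : ℕ, 2 ≤ N ∧
    ∀ (x y : V) (p : Quiver.Path x y), N ≤ p.length → (PathAlgebra.ofPath p : PathAlgebra k V) ∈ I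

/-! ### Toupie quivers and toupie algebras -/

/-- The quiver on `V` is a toupie quiver with source `s` and sink `t`: it has no oriented cycles,
`s` is its only source, `t` is its only sink, and every other vertex is the source of exactly one
arrow and the target of exactly one arrow. -/
structure IsToupie {V : Type u} [Quiver.{v} V] (s t : V) : Prop where
  length_eq_zero : ∀ (x : V) (p : Quiver.Path x x), p.length = 0
  isSource_iff : ∀ x : V, (∀ y : V, IsEmpty (y ⟶ x)) ↔ x = s
  isSink_iff : ∀ x : V, (∀ y : V, IsEmpty (x ⟶ y)) ↔ x = t
  unique_out : ∀ x : V, x ≠ s → x ≠ t → Nonempty (Unique (Σ y : V, (x ⟶ y)))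
  unique_in : ∀ x : V, x ≠ s → x ≠ t → Nonempty (Unique (Σ y : V, (y ⟶ x)))

/-- The class in `kQ / I` of a path. -/
def pathClass {k : Type w} [Field k] {V : Type u} [Quiver.{v} V] [Fintype V]
    (I : Ideal (PathAlgebra k V)) [I.IsTwoSided] {x y : V} (p : Quiver.Path x y) :
    PathAlgebra k V ⧸ I :=
  Ideal.Quotient.mk I (PathAlgebra.ofPath p)

/-- The number `a` of arrows from `s` to `t`. -/
def numArrows {V : Type u} [Quiver.{v} V] (s t : V) : ℕ := Nat.card (s ⟶ t)

/-- The subspace `e_s A e_t` of `A = kQ / I`. -/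
def cornerSpace {k : Type w} [Field k] {V : Type u} [Quiver.{v} V] [Fintype V]
    (I : Ideal (PathAlgebra k V)) [I.IsTwoSided] (s t : V) : Submodule k (PathAlgebra k V ⧸ I) :=
  LinearMap.range
    (LinearMap.mulLeft k (pathClass I (Quiver.Path.nil : Quiver.Path s s)) ∘ₗ
      LinearMap.mulRight k (pathClass I (Quiver.Path.nil : Quiver.Path t t)))

/-- The number `D`, the dimension of `e_s A e_t`. -/
def cornerDim {k : Type w} [Field k] {V : Type u} [Quiver.{v} V] [Fintype V]
    (I : Ideal (PathAlgebra k V)) [I.IsTwoSided] (s t : V) : ℕ :=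
  Module.finrank k (cornerSpace I s t)

/-- The branch `p` (a path from the source `s` to the sink `t`) contains a monomial relation: one of
its subpaths `q` lies in `I`. -/
def ContainsMonomialRelation {k : Type w} [Field k] {V : Type u} [Quiver.{v} V] [Fintype V]
    (I : Ideal (PathAlgebra k V)) {s t : V} (p : Quiver.Path s t) : Prop :=
  ∃ (x y : V) (p₁ : Quiver.Path s x) (q : Quiver.Path x y) (p₂ : Quiver.Path y t),
    p = (p₁.comp q).comp p₂ ∧ (PathAlgebra.ofPath q : PathAlgebra k V) ∈ I

/-- The number `m` of branches that contain monomial relations. -/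
def numMonomialBranches {k : Type w} [Field k] {V : Type u} [Quiver.{v} V] [Fintype V]
    (I : Ideal (PathAlgebra k V)) (s t : V) : ℕ :=
  Nat.card {p : Quiver.Path s t // ContainsMonomialRelation I p}

/-! ### The first Hochschild cohomology -/

namespace Hochschild

attribute [local instance 100] LieRing.ofAssociativeRing

variable (k : Type w) [Field k] (A : Type u) [Ring A] [Algebra k A]

/-- The Hochschild differential `A → Hom(A, A)`, `(d⁰ x)(a) = a x - x a`. -/
def d0 : A →ₗ[k] Module.End k A :=
  (LinearMap.mul k A).flip - LinearMap.mul k A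

/-- The Hochschild differential `Hom(A, A) → Hom(A ⊗ A, A)`,
`(d¹ f)(a, b) = a f(b) - f(a b) + f(a) b`. -/
def d1 : Module.End k A →ₗ[k] (A →ₗ[k] A →ₗ[k] A) where
  toFun f := (LinearMap.mul k A).compl₂ f - (LinearMap.mul k A).compr₂ f + LinearMap.mul k A ∘ₗ f
  map_add' f g := by ext a b; simp; noncomm_ring
  map_smul' c f := by ext a b; simp [smul_sub]

@[simp] theorem d0_apply (x a : A) : d0 k A x a = a * x - x * a := by simp [d0]

@[simp] theorem d1_apply (f : Module.End k A) (a b : A) :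
    d1 k A f a b = a * f b - f (a * b) + f a * b := by simp [d1]

theorem d1_d0 (x : A) : d1 k A (d0 k A x) = 0 := by
  ext a b; simp; noncomm_ring

variable {k A} in
theorem mul_of_mem_cocycles {f : Module.End k A} (hf : f ∈ LinearMap.ker (d1 k A)) (a b : A) :
    f (a * b) = a * f b + f a * b := by
  have h : d1 k A f a b = 0 := by rw [LinearMap.mem_ker.1 hf]; rfl
  rw [d1_apply, sub_add_eq_add_sub, sub_eq_zero] at h
  exact h.symm

/-- The Hochschild `1`-cocycles, with the Gerstenhaber bracket `[f, g] = f ∘ g - g ∘ f`. -/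
def cocycles : LieSubalgebra k (Module.End k A) :=
  { LinearMap.ker (d1 k A) with
    lie_mem' := by
      intro f g hf hg
      have hf' := mul_of_mem_cocycles hf
      have hg' := mul_of_mem_cocycles hg
      change d1 k A ⁅f, g⁆ = 0
      ext a b
      simp only [d1_apply, LieRing.of_associative_ring_bracket, LinearMap.sub_apply,
        Module.End.mul_apply, hf', hg', map_add, LinearMap.zero_apply]
      noncomm_ring }

/-- The Hochschild `1`-coboundaries, as a Lie ideal of the `1`-cocycles. -/
def coboundaries : LieIdeal k (cocycles k A) :=
  { (LinearMap.range (d0 k A)).comap (cocycles k A).toSubmodule.subtype with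
    lie_mem := by
      rintro ⟨f, hf⟩ ⟨_, hg⟩ ⟨x, rfl⟩
      refine ⟨f x, ?_⟩
      have hf' : ∀ a b, f (a * b) = a * f b + f a * b := mul_of_mem_cocycles hf
      ext a
      simp [LieRing.of_associative_ring_bracket, hf', map_sub]
      noncomm_ring }

/-- The first Hochschild cohomology `HH¹(A)`, a Lie algebra with the Gerstenhaber bracket. -/
abbrev HH1 : Type u := cocycles k A ⧸ coboundaries k A

end Hochschild

end

/-! Every class in `HH1` is represented by a normalized derivation, one that kills all vertex
idempotents. Such a derivation preserves each `e_x A e_y`. As the quiver is acyclic and `I ⊆ J²`, it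
also acts, modulo `J²`, by a matrix on the arrows from `x` to `y`. The inner derivation of `z` acts
on these arrows, modulo `J²`, by the scalar `z_y - z_x`, where `z_x` is the coefficient of `e_x` in
`z`.

In a toupie quiver an arrow not going from `s` to `t` is the only path between its ends, so
normalized derivations scale it. If no arrow goes from `s` to `t`, all of them are diagonal, hence
commute, and `HH1` is abelian (`isLieAbelian_HH1`). Non-commutativity therefore forces `a > 0`.

If some branch `p` has length at least two, take the trace on the arrows from `s` to `t` minus `a`
times the sum of the diagonal coefficients along `p`. This functional kills inner derivations and
brackets of normalized ones, but takes the value `a` on the derivation that fixes the arrows from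
`s` to `t` and kills the other paths. So `HH1` is not perfect, and not semisimple
(`not_isSemisimple_HH1`).

If all branches are arrows, the quiver is the Kronecker quiver with `a` arrows and `HH1` is `gl_a`
modulo scalars, that is `sl_a` in characteristic zero (`slToHH1_injective`, `slToHH1_surjective`).
It is simple because it is not abelian.

Finally, `a = D` and `m = 0` say exactly that no long branch exists: if `a = D`, a long branch is a
combination of arrows modulo `I`, hence lies in `I` and is itself a monomial relation. -/

noncomputable section

universe u v w

/-! ### Vertex and arrow coefficients of products in the path algebra -/

namespace PathAlgebra

variable {k : Type w} [Field k] {V : Type u} [Quiver.{v} V]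

/-- The coefficient of a path, as a linear functional on the path algebra. -/
def coeffHom {x y : V} (p : Quiver.Path x y) : PathAlgebra k V →ₗ[k] k := basis.coord ⟨x, y, p⟩

theorem coeff_zero {x y : V} (p : Quiver.Path x y) : (0 : PathAlgebra k V).coeff p = 0 :=
  map_zero (coeffHom p)

theorem coeff_ofPath_self {x y : V} (p : Quiver.Path x y) :
    (ofPath p : PathAlgebra k V).coeff p = 1 := by
  simp [coeff, ofPath]

theorem coeff_ofPath_of_ne {x y x' y' : V} {p : Quiver.Path x y} {q : Quiver.Path x' y'}
    (h : (⟨x', y', q⟩ : Σ x : V, Σ y : V, Quiver.Path x y) ≠ ⟨x, y, p⟩) :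
    (ofPath q : PathAlgebra k V).coeff p = 0 := by
  simp only [coeff, ofPath, Module.Basis.repr_self]
  exact Finsupp.single_eq_of_ne' h

theorem coeff_ofPath_of_path_ne {x y : V} {p q : Quiver.Path x y} (h : q ≠ p) :
    (ofPath q : PathAlgebra k V).coeff p = 0 :=
  coeff_ofPath_of_ne fun H => h (by simpa using H)

theorem coeff_ofPath_of_source_ne {x y x' y' : V} (p : Quiver.Path x y) (q : Quiver.Path x' y')
    (h : x' ≠ x) : (ofPath q : PathAlgebra k V).coeff p = 0 :=
  coeff_ofPath_of_ne fun H => h (congrArg Sigma.fst H)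

theorem coeff_ofPath_of_target_ne {x y x' y' : V} (p : Quiver.Path x y) (q : Quiver.Path x' y')
    (h : y' ≠ y) : (ofPath q : PathAlgebra k V).coeff p = 0 :=
  coeff_ofPath_of_ne fun H =>
    h (congrArg (fun r : Σ x : V, Σ y : V, Quiver.Path x y => r.2.1) H)

theorem coeff_ofPath_of_length_ne {x y x' y' : V} (p : Quiver.Path x y) (q : Quiver.Path x' y')
    (h : q.length ≠ p.length) : (ofPath q : PathAlgebra k V).coeff p = 0 :=
  coeff_ofPath_of_ne fun H =>
    h (congrArg (fun r : Σ x : V, Σ y : V, Quiver.Path x y => r.2.2.length) H)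

variable [Fintype V]

/-- Two bilinear maps on the path algebra that agree on pairs of paths are equal. -/
theorem bilinear_ext {M : Type*} [AddCommGroup M] [Module k M]
    {F G : PathAlgebra k V →ₗ[k] PathAlgebra k V →ₗ[k] M}
    (h : ∀ (x y x' y' : V) (p : Quiver.Path x y) (q : Quiver.Path x' y'),
      F (ofPath p) (ofPath q) = G (ofPath p) (ofPath q)) : F = G :=
  linearMap_ext fun x y p => linearMap_ext fun x' y' q => h x y x' y' p q

/-- A stationary path factors only into stationary paths at the same vertex. -/
theorem coeff_nil_mul (x : V) (f g : PathAlgebra k V) :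
    (f * g).coeff (Quiver.Path.nil : Quiver.Path x x) =
      f.coeff (Quiver.Path.nil : Quiver.Path x x) * g.coeff (Quiver.Path.nil : Quiver.Path x x) := by
  let c : PathAlgebra k V →ₗ[k] k := coeffHom (Quiver.Path.nil : Quiver.Path x x)
  have key : (LinearMap.mul k (PathAlgebra k V)).compr₂ c =
      (LinearMap.mul k k).compl₁₂ c c := by
    refine bilinear_ext fun u v v' w p q => ?_
    change (ofPath p * ofPath q : PathAlgebra k V).coeff (Quiver.Path.nil : Quiver.Path x x) =
      (ofPath p : PathAlgebra k V).coeff (Quiver.Path.nil : Quiver.Path x x) *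
        (ofPath q : PathAlgebra k V).coeff (Quiver.Path.nil : Quiver.Path x x)
    by_cases hv : v = v'
    · subst hv
      rw [ofPath_mul_ofPath]
      cases p with
      | cons p e =>
        rw [coeff_ofPath_of_length_ne _ (p.cons e) (by simp), zero_mul,
          coeff_ofPath_of_length_ne _ _ (by simp)]
      | nil =>
        rw [Quiver.Path.nil_comp]
        by_cases hu : u = x
        · subst hu
          rw [coeff_ofPath_self, one_mul]
        · rw [coeff_ofPath_of_source_ne _ _ hu, coeff_ofPath_of_source_ne _ _ hu, zero_mul]
    · rw [ofPath_mul_ofPath_of_ne _ _ hv]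
      rw [coeff_zero]
      by_cases hvx : v = x
      · rw [coeff_ofPath_of_source_ne _ q fun h => hv (hvx.trans h.symm), mul_zero]
      · rw [coeff_ofPath_of_target_ne _ p hvx, zero_mul]
  exact LinearMap.congr_fun (LinearMap.congr_fun key f) g

/-- The only factorizations of an arrow are `e_x · α` and `α · e_y`. This twisted Leibniz rule is
what later makes `arrowEnd` a derivation. -/
theorem coeff_toPath_mul {x y : V} (α : x ⟶ y) (f g : PathAlgebra k V) :
    (f * g).coeff α.toPath =
      f.coeff (Quiver.Path.nil : Quiver.Path x x) * g.coeff α.toPath +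
        f.coeff α.toPath * g.coeff (Quiver.Path.nil : Quiver.Path y y) := by
  let c : PathAlgebra k V →ₗ[k] k := coeffHom α.toPath
  let cx : PathAlgebra k V →ₗ[k] k := coeffHom (Quiver.Path.nil : Quiver.Path x x)
  let cy : PathAlgebra k V →ₗ[k] k := coeffHom (Quiver.Path.nil : Quiver.Path y y)
  have key : (LinearMap.mul k (PathAlgebra k V)).compr₂ c =
      (LinearMap.mul k k).compl₁₂ cx c + (LinearMap.mul k k).compl₁₂ c cy := by
    refine bilinear_ext fun u v v' w p q => ?_
    change (ofPath p * ofPath q : PathAlgebra k V).coeff α.toPath =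
      (ofPath p : PathAlgebra k V).coeff (Quiver.Path.nil : Quiver.Path x x) * (ofPath q : PathAlgebra k V).coeff α.toPath +
        (ofPath p : PathAlgebra k V).coeff α.toPath * (ofPath q : PathAlgebra k V).coeff (Quiver.Path.nil : Quiver.Path y y)
    by_cases hv : v = v'
    · subst hv
      rw [ofPath_mul_ofPath]
      cases p with
      | nil =>
        rw [Quiver.Path.nil_comp, coeff_ofPath_of_length_ne α.toPath (Quiver.Path.nil) (by simp),
          zero_mul, add_zero]
        by_cases hu : u = x
        · subst hu
          rw [coeff_ofPath_self, one_mul]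
        · rw [coeff_ofPath_of_source_ne _ _ hu, coeff_ofPath_of_source_ne _ _ hu, zero_mul]
      | cons p e =>
        rw [coeff_ofPath_of_length_ne (Quiver.Path.nil : Quiver.Path x x) (p.cons e) (by simp),
          zero_mul, zero_add]
        cases q with
        | nil =>
          rw [Quiver.Path.comp_nil]
          by_cases hu : v = y
          · subst hu
            rw [coeff_ofPath_self, mul_one]
          · rw [coeff_ofPath_of_target_ne _ _ hu, coeff_ofPath_of_target_ne _ _ hu, mul_zero]
        | cons q e' =>
          rw [coeff_ofPath_of_length_ne (Quiver.Path.nil : Quiver.Path y y) (q.cons e') (by simp),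
            mul_zero, coeff_ofPath_of_length_ne _ _ (by
              simp only [Quiver.Path.length_comp, Quiver.Path.length_cons,
                Quiver.Path.length_toPath]; omega)]
    · rw [ofPath_mul_ofPath_of_ne _ _ hv]
      rw [coeff_zero]
      by_cases hvx : v = x
      · rw [coeff_ofPath_of_source_ne _ q fun h => hv (hvx.trans h.symm), mul_zero, zero_add]
        by_cases hvy : v = y
        · rw [coeff_ofPath_of_source_ne _ q fun h => hv (hvy.trans h.symm), mul_zero]
        · rw [coeff_ofPath_of_target_ne _ p hvy, zero_mul]
      · rw [coeff_ofPath_of_target_ne _ p hvx, zero_mul, zero_add]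
        by_cases hvy : v = y
        · rw [coeff_ofPath_of_source_ne _ q fun h => hv (hvy.trans h.symm), mul_zero]
        · rw [coeff_ofPath_of_target_ne _ p hvy, zero_mul]
  exact LinearMap.congr_fun (LinearMap.congr_fun key f) g

end PathAlgebra

/-! ### Vertex and arrow coefficients on the quotient algebra -/

section QuotientCoefficients

variable {k : Type w} [Field k] {V : Type u} [Quiver.{v} V] [Fintype V]

/-- The ideal `I` is contained in the square of the arrow ideal: its elements only involve paths of
length at least two. -/
def InArrowSquare (I : Ideal (PathAlgebra k V)) : Prop :=
  ∀ f ∈ I, ∀ (x y : V) (p : Quiver.Path x y), f.coeff p ≠ 0 → 2 ≤ p.length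

theorem InArrowSquare.coeff_eq_zero {I : Ideal (PathAlgebra k V)} (hI : InArrowSquare I)
    {f : PathAlgebra k V} (hf : f ∈ I) {x y : V} (p : Quiver.Path x y) (hp : p.length < 2) :
    f.coeff p = 0 := by
  by_contra h
  exact absurd (hI f hf x y p h) (by omega)

theorem two_le_length_of_containsMonomialRelation {I : Ideal (PathAlgebra k V)}
    (hI : InArrowSquare I) {s t : V} {p : Quiver.Path s t}
    (hp : ContainsMonomialRelation I p) : 2 ≤ p.length := by
  obtain ⟨x, y, p₁, q, p₂, rfl, hq⟩ := hp
  have := hI _ hq x y q (by rw [PathAlgebra.coeff_ofPath_self]; exact one_ne_zero)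
  rw [Quiver.Path.length_comp, Quiver.Path.length_comp]
  omega

variable {I : Ideal (PathAlgebra k V)} [I.IsTwoSided]

/-- A linear map on `kQ` that vanishes on `I`, as a linear map on `kQ / I`. -/
def quotientLift {M : Type*} [AddCommGroup M] [Module k M] (F : PathAlgebra k V →ₗ[k] M)
    (h : ∀ f ∈ I, F f = 0) : (PathAlgebra k V ⧸ I) →ₗ[k] M where
  toFun := QuotientAddGroup.lift I.toAddSubgroup F.toAddMonoidHom h
  map_add' := map_add _
  map_smul' c a := by
    obtain ⟨f, rfl⟩ := Ideal.Quotient.mk_surjective a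
    exact F.map_smul c f

/-- Two linear maps on `kQ / I` that agree on the classes of paths are equal. -/
theorem quotient_linearMap_ext {M : Type*} [AddCommGroup M] [Module k M]
    {F G : (PathAlgebra k V ⧸ I) →ₗ[k] M}
    (h : ∀ (x y : V) (p : Quiver.Path x y), F (pathClass I p) = G (pathClass I p)) : F = G := by
  have key : F ∘ₗ (Ideal.Quotient.mkₐ k I).toLinearMap =
      G ∘ₗ (Ideal.Quotient.mkₐ k I).toLinearMap := PathAlgebra.linearMap_ext h
  refine LinearMap.ext fun a => ?_
  obtain ⟨f, rfl⟩ := Ideal.Quotient.mk_surjective a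
  exact LinearMap.congr_fun key f

/-- The coefficient in an element of `kQ / I` of a vertex. -/
def vertexCoeff (hI : InArrowSquare I) (x : V) : (PathAlgebra k V ⧸ I) →ₗ[k] k :=
  quotientLift (PathAlgebra.coeffHom (Quiver.Path.nil : Quiver.Path x x))
    fun _ hf => hI.coeff_eq_zero hf _ (by simp)

/-- The coefficient in an element of `kQ / I` of an arrow. -/
def arrowCoeff (hI : InArrowSquare I) {x y : V} (α : x ⟶ y) : (PathAlgebra k V ⧸ I) →ₗ[k] k :=
  quotientLift (PathAlgebra.coeffHom α.toPath) fun _ hf => hI.coeff_eq_zero hf _ (by simp)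

theorem arrowCoeff_pathClass (hI : InArrowSquare I) {z w : V} (α : z ⟶ w) {x y : V}
    (p : Quiver.Path x y) :
    arrowCoeff hI α (pathClass I p) = (PathAlgebra.ofPath p : PathAlgebra k V).coeff α.toPath := rfl

theorem vertexCoeff_mul (hI : InArrowSquare I) (x : V) (a b : PathAlgebra k V ⧸ I) :
    vertexCoeff hI x (a * b) = vertexCoeff hI x a * vertexCoeff hI x b := by
  obtain ⟨f, rfl⟩ := Ideal.Quotient.mk_surjective a
  obtain ⟨g, rfl⟩ := Ideal.Quotient.mk_surjective b
  exact PathAlgebra.coeff_nil_mul x f g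

theorem arrowCoeff_mul (hI : InArrowSquare I) {x y : V} (α : x ⟶ y) (a b : PathAlgebra k V ⧸ I) :
    arrowCoeff hI α (a * b) =
      vertexCoeff hI x a * arrowCoeff hI α b + arrowCoeff hI α a * vertexCoeff hI y b := by
  obtain ⟨f, rfl⟩ := Ideal.Quotient.mk_surjective a
  obtain ⟨g, rfl⟩ := Ideal.Quotient.mk_surjective b
  exact PathAlgebra.coeff_toPath_mul α f g

variable (I) in
/-- The idempotent of `kQ / I` given by a vertex. -/
abbrev vertexClass (x : V) : PathAlgebra k V ⧸ I := pathClass I (Quiver.Path.nil : Quiver.Path x x)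

variable (I) in
/-- The class in `kQ / I` of an arrow. -/
abbrev arrowClass {x y : V} (α : x ⟶ y) : PathAlgebra k V ⧸ I := pathClass I α.toPath

theorem pathClass_mul {x y z : V} (p : Quiver.Path x y) (q : Quiver.Path y z) :
    pathClass I p * pathClass I q = pathClass I (p.comp q) := by
  rw [pathClass, pathClass, ← map_mul, PathAlgebra.ofPath_mul_ofPath, pathClass]

theorem pathClass_mul_of_ne {x y x' y' : V} (p : Quiver.Path x y) (q : Quiver.Path x' y')
    (h : y ≠ x') : pathClass I p * pathClass I q = 0 := by
  rw [pathClass, pathClass, ← map_mul, PathAlgebra.ofPath_mul_ofPath_of_ne _ _ h, map_zero]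

theorem pathClass_cons {x y z : V} (p : Quiver.Path x y) (α : y ⟶ z) :
    pathClass I (p.cons α) = pathClass I p * arrowClass I α := by
  rw [pathClass_mul]; rfl

theorem sum_vertexClass : ∑ x : V, vertexClass I x = (1 : PathAlgebra k V ⧸ I) := by
  rw [← map_one (Ideal.Quotient.mk I), PathAlgebra.one_def, map_sum]
  rfl

theorem vertexClass_mul_pathClass {x y : V} (p : Quiver.Path x y) :
    vertexClass I x * pathClass I p = pathClass I p := by
  rw [pathClass_mul, Quiver.Path.nil_comp]

theorem pathClass_mul_vertexClass {x y : V} (p : Quiver.Path x y) :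
    pathClass I p * vertexClass I y = pathClass I p := by
  rw [pathClass_mul, Quiver.Path.comp_nil]

theorem vertexCoeff_vertexClass_self (hI : InArrowSquare I) (x : V) :
    vertexCoeff hI x (vertexClass I x) = 1 :=
  PathAlgebra.coeff_ofPath_self _

theorem vertexCoeff_vertexClass_of_ne (hI : InArrowSquare I) {x z : V} (h : x ≠ z) :
    vertexCoeff hI z (vertexClass I x) = 0 :=
  PathAlgebra.coeff_ofPath_of_source_ne _ _ h

theorem vertexCoeff_pathClass_of_pos (hI : InArrowSquare I) (z : V) {x y : V}
    (p : Quiver.Path x y) (hp : 0 < p.length) : vertexCoeff hI z (pathClass I p) = 0 :=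
  PathAlgebra.coeff_ofPath_of_length_ne _ _ (by simpa using hp.ne')

theorem arrowCoeff_vertexClass (hI : InArrowSquare I) {x y : V} (α : x ⟶ y) (z : V) :
    arrowCoeff hI α (vertexClass I z) = 0 :=
  PathAlgebra.coeff_ofPath_of_length_ne _ _ (by simp)

theorem arrowCoeff_arrowClass (hI : InArrowSquare I) {x y : V} [DecidableEq (x ⟶ y)] (α β : x ⟶ y) :
    arrowCoeff hI α (arrowClass I β) = if α = β then 1 else 0 := by
  rw [arrowCoeff_pathClass]
  split_ifs with h
  · rw [h, PathAlgebra.coeff_ofPath_self]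
  · refine PathAlgebra.coeff_ofPath_of_path_ne fun H => h ?_
    exact (eq_of_heq (Quiver.Path.hom_heq_of_cons_eq_cons H)).symm

theorem arrowCoeff_pathClass_of_length (hI : InArrowSquare I) {x y : V} (α : x ⟶ y) {x' y' : V}
    (p : Quiver.Path x' y') (hp : p.length ≠ 1) : arrowCoeff hI α (pathClass I p) = 0 :=
  PathAlgebra.coeff_ofPath_of_length_ne _ _ (by simpa using hp)

theorem arrowCoeff_pathClass_of_ne (hI : InArrowSquare I) {x y : V} (α : x ⟶ y) {x' y' : V}
    (p : Quiver.Path x' y') (h : x' ≠ x ∨ y' ≠ y) : arrowCoeff hI α (pathClass I p) = 0 :=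
  h.elim (PathAlgebra.coeff_ofPath_of_source_ne _ _) (PathAlgebra.coeff_ofPath_of_target_ne _ _)

end QuotientCoefficients

/-! ### Semisimple and simple Lie algebras -/

namespace LieAlgebra

attribute [local instance 100] LieRing.ofAssociativeRing

/-- A linear functional on a semisimple Lie algebra that vanishes on all brackets is zero. -/
theorem IsSemisimple.eq_zero_of_map_lie {k L : Type*} [Field k] [LieRing L] [LieAlgebra k L]
    [IsSemisimple k L] (φ : L →ₗ[k] k) (h : ∀ x y : L, φ ⁅x, y⁆ = 0) : φ = 0 := by
  set D : LieIdeal k L := ⁅(⊤ : LieIdeal k L), (⊤ : LieIdeal k L)⁆ with hD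
  -- The ideals of a semisimple Lie algebra form a Boolean algebra. The complement of the derived
  -- ideal is abelian, since its brackets lie in both, so it vanishes and the algebra is perfect.
  have hC : Dᶜ = ⊥ := by
    refine (hasTrivialRadical_iff_no_abelian_ideals k L).1 inferInstance _ ?_
    rw [LieSubmodule.lie_abelian_iff_lie_self_eq_bot, eq_bot_iff]
    calc ⁅Dᶜ, Dᶜ⁆ ≤ D ⊓ Dᶜ := le_inf (LieSubmodule.mono_lie le_top le_top) (LieSubmodule.lie_le_right _ _)
      _ ≤ ⊥ := by rw [inf_compl_eq_bot]
  have hT : D = ⊤ := by rwa [compl_eq_bot] at hC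
  refine LinearMap.ext fun x => ?_
  have hx : x ∈ D.toSubmodule := by rw [hT]; trivial
  rw [hD, LieSubmodule.lieIdeal_oper_eq_linear_span'] at hx
  refine Submodule.span_induction (p := fun x _ => φ x = 0) ?_ (map_zero φ) ?_ ?_ hx
  · rintro _ ⟨y, -, z, -, rfl⟩
    exact h y z
  · intro y z _ _ hy hz
    rw [map_add, hy, hz, add_zero]
  · intro c y _ hy
    rw [map_smul, hy, smul_zero]

/-- Simplicity is invariant under isomorphisms of Lie algebras. -/
theorem IsSimple.of_equiv {k L L' : Type*} [CommRing k] [LieRing L] [LieAlgebra k L] [LieRing L']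
    [LieAlgebra k L'] [IsSimple k L] (e : L ≃ₗ⁅k⁆ L') : IsSimple k L' where
  eq_bot_or_eq_top J := by
    rcases IsSimple.eq_bot_or_eq_top (R := k) (J.comap e.toLieHom) with h | h
    · left
      refine (LieSubmodule.eq_bot_iff _).2 fun x hx => ?_
      have : e.symm x ∈ J.comap e.toLieHom := by
        rw [LieIdeal.mem_comap]; simpa using hx
      rw [h, LieSubmodule.mem_bot] at this
      simpa using congrArg e this
    · right
      refine eq_top_iff.2 fun x _ => ?_
      have : e.symm x ∈ J.comap e.toLieHom := by rw [h]; trivial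
      rw [LieIdeal.mem_comap] at this
      simpa using this
  non_abelian h := IsSimple.non_abelian k (L := L)
    ((lie_abelian_iff_equiv_lie_abelian e).2 h)

/-! ### Simplicity of the special linear Lie algebra -/

namespace SpecialLinear

open Matrix

variable {n k : Type*} [Fintype n] [DecidableEq n] [Field k]

/-- With `E = E_ij` and `E² = 0`, the double bracket reduces to `-2 E x E`, and `E x E = x_ji E`. -/
theorem lie_single_single_self {i j : n} (h : i ≠ j) (x : sl n k) :
    ⁅single i j h (1 : k), ⁅single i j h (1 : k), x⁆⁆ = (-2 * x.1 j i) • single i j h (1 : k) := by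
  apply Subtype.ext
  simp only [sl_bracket, val_single, SetLike.val_smul]
  have h1 : Matrix.single i j (1 : k) * Matrix.single i j (1 : k) = 0 :=
    Matrix.single_mul_single_of_ne _ _ _ _ h.symm _
  have h2 : Matrix.single i j (1 : k) * x.1 * Matrix.single i j (1 : k) =
      (x.1 j i) • Matrix.single i j (1 : k) := by
    rw [Matrix.single_mul_mul_single]; simp
  rw [mul_sub, sub_mul, ← mul_assoc, h1, mul_assoc x.1, h1, ← mul_assoc, h2]
  simp only [zero_mul, mul_zero]
  module

/-- A nonzero off-diagonal entry of an element of `J` is isolated by a double bracket. A nonzero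
diagonal element has two distinct diagonal entries, because a traceless scalar matrix is zero in
characteristic zero; one bracket with `E_ij` then gives a nonzero multiple of `E_ij`. -/
theorem exists_single_mem [CharZero k] (J : LieIdeal k (sl n k)) (hJ : J ≠ ⊥) :
    ∃ (i j : n) (h : i ≠ j), single i j h (1 : k) ∈ J := by
  obtain ⟨x, hx, hx0⟩ : ∃ x ∈ J, x ≠ 0 := by
    by_contra! H
    exact hJ ((LieSubmodule.eq_bot_iff _).2 H)
  by_cases hd : ∃ i j, i ≠ j ∧ x.1 j i ≠ 0
  · obtain ⟨i, j, hij, h⟩ := hd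
    refine ⟨i, j, hij, ?_⟩
    have := J.lie_mem (x := single i j hij (1 : k)) (J.lie_mem (x := single i j hij (1 : k)) hx)
    rw [lie_single_single_self] at this
    exact (Submodule.smul_mem_iff J.toSubmodule
      (mul_ne_zero (neg_ne_zero.2 two_ne_zero) h)).1 this
  · push Not at hd
    have hdiag : ∃ i j, x.1 i i ≠ x.1 j j := by
      by_contra! H
      apply hx0
      have htr : ∑ i, x.1 i i = 0 := x.2
      apply Subtype.ext
      ext i j
      by_cases hij : j = i
      · subst hij
        rw [Finset.sum_congr rfl fun i _ => H i j, Finset.sum_const, nsmul_eq_mul] at htr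
        have : ((Finset.univ : Finset n).card : k) ≠ 0 := by
          rw [Nat.cast_ne_zero]; exact Finset.card_ne_zero_of_mem (Finset.mem_univ j)
        exact (mul_eq_zero.1 htr).resolve_left this
      · exact hd j i hij
    obtain ⟨i, j, h⟩ := hdiag
    have hij : i ≠ j := by rintro rfl; exact h rfl
    refine ⟨i, j, hij, ?_⟩
    have hmem := J.lie_mem (x := single i j hij (1 : k)) hx
    have hdx : x.1 = Matrix.diagonal fun i => x.1 i i := by
      ext a b
      by_cases hab : a = b
      · subst hab; simp
      · rw [Matrix.diagonal_apply_ne _ hab]; exact hd b a (Ne.symm hab)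
    have heq : ⁅single i j hij (1 : k), x⁆ = (x.1 j j - x.1 i i) • single i j hij (1 : k) := by
      apply Subtype.ext
      simp only [sl_bracket, val_single, SetLike.val_smul]
      generalize hd' : (fun i => x.1 i i) = d at hdx
      have e1 : x.1 j j = d j := by rw [← hd']
      have e2 : x.1 i i = d i := by rw [← hd']
      rw [e1, e2, hdx]
      ext a b
      simp only [Matrix.sub_apply, Matrix.mul_diagonal, Matrix.diagonal_mul, Matrix.smul_apply,
        Matrix.single_apply, smul_eq_mul]
      split_ifs with hab
      · rw [hab.1, hab.2]; ring
      · ring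
    rw [heq] at hmem
    exact (Submodule.smul_mem_iff J.toSubmodule (sub_ne_zero.2 h.symm)).1 hmem

theorem lie_single_single {i j l : n} (hij : i ≠ j) (hjl : j ≠ l) (hil : i ≠ l) :
    ⁅single i j hij (1 : k), single j l hjl (1 : k)⁆ = single i l hil (1 : k) := by
  apply Subtype.ext
  simp only [sl_bracket, val_single, Matrix.single_mul_single_same, one_mul,
    Matrix.single_mul_single_of_ne _ _ _ _ hil.symm, sub_zero]

/-- Brackets of elementary matrices move the column index (`row`) and the row index (`col`). The
transposed matrix `E_ji`, needed when `b = i`, comes from the double bracket of `E_ji` with `E_ij`.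
-/
theorem single_mem_of_single_mem [CharZero k] {J : LieIdeal k (sl n k)} {i j : n} {h : i ≠ j}
    (hJ : single i j h (1 : k) ∈ J) {a b : n} (hab : a ≠ b) : single a b hab (1 : k) ∈ J := by
  have row : ∀ {i j : n} (h : i ≠ j), single i j h (1 : k) ∈ J →
      ∀ {b : n} (hb : i ≠ b), single i b hb (1 : k) ∈ J := by
    intro i j h hJ b hb
    by_cases hjb : j = b
    · subst hjb; exact hJ
    · rw [← lie_single_single h hjb hb, ← lie_skew]
      exact J.neg_mem (J.lie_mem hJ)
  have col : ∀ {i j : n} (h : i ≠ j), single i j h (1 : k) ∈ J →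
      ∀ {a : n} (ha : a ≠ j), single a j ha (1 : k) ∈ J := by
    intro i j h hJ a ha
    by_cases hai : a = i
    · subst hai; exact hJ
    · rw [← lie_single_single hai h ha]
      exact J.lie_mem hJ
  have swap : single j i h.symm (1 : k) ∈ J := by
    have := J.lie_mem (x := single j i h.symm (1 : k)) (J.lie_mem (x := single j i h.symm (1 : k)) hJ)
    rw [lie_single_single_self] at this
    refine (Submodule.smul_mem_iff J.toSubmodule (?_ : (-2 * 1 : k) ≠ 0)).1 ?_
    · simp
    · simpa using this
  by_cases hib : i = b
  · subst hib
    exact col h.symm swap hab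
  · exact col hib (row h hJ hib) hab

/-- The special linear Lie algebra over a field of characteristic zero is simple if it is not
abelian. -/
theorem isSimple [CharZero k] (h : ¬ IsLieAbelian (sl n k)) : IsSimple k (sl n k) where
  non_abelian := h
  eq_bot_or_eq_top J := by
    refine or_iff_not_imp_left.2 fun hJ => ?_
    obtain ⟨i, j, hij, hmem⟩ := exists_single_mem J hJ
    have hs : ∀ a b (hab : a ≠ b), single a b hab (1 : k) ∈ J :=
      fun a b hab => single_mem_of_single_mem hmem hab
    have hd : ∀ a b, singleSubSingle a b (1 : k) ∈ J := by
      intro a b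
      by_cases hab : a = b
      · subst hab
        have : singleSubSingle a a (1 : k) = 0 := Subtype.ext (by simp)
        rw [this]; exact J.zero_mem
      · have : singleSubSingle a b (1 : k) =
            ⁅single a b hab (1 : k), single b a (Ne.symm hab) (1 : k)⁆ := Subtype.ext (by
          rw [sl_bracket, val_single, val_single, Matrix.single_mul_single_same,
            Matrix.single_mul_single_same, val_singleSubSingle, one_mul])
        rw [this]
        exact J.lie_mem (hs _ _ _)
    refine eq_top_iff.2 fun x _ => ?_
    have htr : ∑ a, x.1 a a = 0 := x.2
    -- As the trace is zero, each `E_aa` on the diagonal may be replaced by `E_aa - E_ii` for the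
    -- fixed index `i`.
    have hx : x = ∑ a, ∑ b, if hab : a = b then x.1 a a • singleSubSingle a i (1 : k)
        else x.1 a b • single a b hab (1 : k) := by
      apply Subtype.ext
      have : ∀ a b, ((if hab : a = b then x.1 a a • singleSubSingle a i (1 : k)
          else x.1 a b • single a b hab (1 : k) : sl n k) : Matrix n n k) =
          Matrix.single a b (x.1 a b) - if a = b then x.1 a a • Matrix.single i i 1 else 0 := by
        intro a b
        split_ifs with hab
        · subst hab; simp [smul_sub]
        · simp
      simp only [AddSubmonoidClass.coe_finsetSum, this, Finset.sum_sub_distrib,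
        Finset.sum_ite_eq, Finset.mem_univ, if_true, ← Finset.sum_smul, htr, zero_smul, sub_zero]
      exact Matrix.matrix_eq_sum_single x.1
    rw [hx]
    refine sum_mem fun a _ => sum_mem fun b _ => ?_
    split_ifs with hab
    · exact J.smul_mem _ (hd _ _)
    · exact J.smul_mem _ (hs _ _ _)

end SpecialLinear

end LieAlgebra

/-! ### Normalized derivations and their action on arrows -/

section Derivations

open Hochschild

attribute [local instance 100] LieRing.ofAssociativeRing

variable {k : Type w} [Field k] {V : Type u} [Quiver.{v} V] [Fintype V]
  {I : Ideal (PathAlgebra k V)} [I.IsTwoSided]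

theorem Hochschild.map_mul_of_mem {A : Type*} [Ring A] [Algebra k A] {δ : Module.End k A}
    (hδ : δ ∈ cocycles k A) (a b : A) : δ (a * b) = a * δ b + δ a * b :=
  mul_of_mem_cocycles hδ a b

theorem Hochschild.mem_cocycles {A : Type*} [Ring A] [Algebra k A] {δ : Module.End k A}
    (hδ : ∀ a b, δ (a * b) = a * δ b + δ a * b) : δ ∈ cocycles k A := by
  change d1 k A δ = 0
  ext a b
  simp only [d1_apply, hδ, LinearMap.zero_apply]
  abel

theorem Hochschild.d0_mem_cocycles {A : Type*} [Ring A] [Algebra k A] (z : A) :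
    d0 k A z ∈ cocycles k A := d1_d0 k A z

/-- A linear endomorphism of `kQ / I` is normalized if it kills the idempotents of the vertices. -/
def IsNormalized (δ : Module.End k (PathAlgebra k V ⧸ I)) : Prop :=
  ∀ x : V, δ (vertexClass I x) = 0

theorem exists_d0_eq_on_vertexClass {δ : Module.End k (PathAlgebra k V ⧸ I)}
    (hδ : δ ∈ cocycles k (PathAlgebra k V ⧸ I)) :
    ∃ z, IsNormalized (δ - d0 k (PathAlgebra k V ⧸ I) z) := by
  classical
  -- For `z = ∑ e_x δ(e_x)`, the Leibniz rule on `e_x e_y` gives `z e_y = e_y δ(e_y) - δ(e_y)`,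
  -- while `e_y z = e_y δ(e_y)`. Hence `e_y z - z e_y = δ(e_y)`.
  refine ⟨∑ x, vertexClass I x * δ (vertexClass I x), fun y => ?_⟩
  have h1 : vertexClass I y * ∑ x, vertexClass I x * δ (vertexClass I x) =
      vertexClass I y * δ (vertexClass I y) := by
    rw [Finset.mul_sum, Finset.sum_eq_single y]
    · rw [← mul_assoc, vertexClass_mul_pathClass]
    · intro x _ hx
      rw [← mul_assoc, pathClass_mul_of_ne _ _ hx.symm, zero_mul]
    · simp
  have h2 : ∀ x, vertexClass I x * δ (vertexClass I x) * vertexClass I y =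
      (if x = y then vertexClass I x * δ (vertexClass I y) else 0) -
        vertexClass I x * δ (vertexClass I y) := by
    intro x
    have h := map_mul_of_mem hδ (vertexClass I x) (vertexClass I y)
    have h' : δ (vertexClass I x) * vertexClass I y =
        δ (vertexClass I x * vertexClass I y) - vertexClass I x * δ (vertexClass I y) := by
      rw [h]; abel
    rw [mul_assoc, h', mul_sub, ← mul_assoc, vertexClass_mul_pathClass]
    congr 1
    split_ifs with hxy
    · subst hxy; rw [vertexClass_mul_pathClass]
    · rw [pathClass_mul_of_ne _ _ hxy, map_zero, mul_zero]
  rw [LinearMap.sub_apply, d0_apply, h1, Finset.sum_mul, Finset.sum_congr rfl fun x _ => h2 x,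
    Finset.sum_sub_distrib, Finset.sum_ite_eq', if_pos (Finset.mem_univ y), ← Finset.sum_mul,
    sum_vertexClass, one_mul]
  abel

/-- Every class in `HH¹(kQ / I)` is represented by a normalized derivation. -/
theorem exists_isNormalized_rep (a : HH1 k (PathAlgebra k V ⧸ I)) :
    ∃ δ : cocycles k (PathAlgebra k V ⧸ I),
      IsNormalized δ.1 ∧ LieSubmodule.Quotient.mk (N := coboundaries k _) δ = a := by
  obtain ⟨δ, rfl⟩ := LieSubmodule.Quotient.surjective_mk' _ a
  obtain ⟨z, hz⟩ := exists_d0_eq_on_vertexClass δ.2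
  refine ⟨δ - ⟨d0 k _ z, d0_mem_cocycles z⟩, hz, ?_⟩
  refine (Submodule.Quotient.eq _).2 ?_
  refine ⟨-z, ?_⟩
  rw [map_neg]
  change _ = δ.1 - d0 k _ z - δ.1
  abel

/-- Two derivations of `kQ / I` that agree on vertices and arrows are equal. -/
theorem cocycle_ext {δ η : Module.End k (PathAlgebra k V ⧸ I)}
    (hδ : δ ∈ cocycles k (PathAlgebra k V ⧸ I)) (hη : η ∈ cocycles k (PathAlgebra k V ⧸ I))
    (hv : ∀ x, δ (vertexClass I x) = η (vertexClass I x))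
    (ha : ∀ (x y : V) (α : x ⟶ y), δ (arrowClass I α) = η (arrowClass I α)) : δ = η := by
  refine quotient_linearMap_ext fun x y p => ?_
  induction p with
  | nil => exact hv x
  | cons p α ih => rw [pathClass_cons, map_mul_of_mem hδ, map_mul_of_mem hη, ih, ha]

theorem map_pathClass_of_isNormalized {δ : Module.End k (PathAlgebra k V ⧸ I)}
    (hδ : δ ∈ cocycles k (PathAlgebra k V ⧸ I)) (hn : IsNormalized δ) {x y : V}
    (p : Quiver.Path x y) :
    δ (pathClass I p) = vertexClass I x * δ (pathClass I p) * vertexClass I y := by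
  have h1 : δ (pathClass I p) = vertexClass I x * δ (pathClass I p) := by
    conv_lhs => rw [← vertexClass_mul_pathClass p, map_mul_of_mem hδ, hn, zero_mul, add_zero]
  have h2 : δ (pathClass I p) = δ (pathClass I p) * vertexClass I y := by
    conv_lhs => rw [← pathClass_mul_vertexClass p, map_mul_of_mem hδ, hn, mul_zero, zero_add]
  rw [← h1, ← h2]

/-- Acyclicity makes a path either stationary, hence killed, or a path between distinct vertices `x`
and `y`; the space `e_x A e_y` then has no vertex component. -/
theorem vertexCoeff_map_pathClass (hI : InArrowSquare I)
    (hac : ∀ (x : V) (p : Quiver.Path x x), p.length = 0)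
    {δ : Module.End k (PathAlgebra k V ⧸ I)} (hδ : δ ∈ cocycles k (PathAlgebra k V ⧸ I))
    (hn : IsNormalized δ) (z : V) {x y : V} (p : Quiver.Path x y) :
    vertexCoeff hI z (δ (pathClass I p)) = 0 := by
  by_cases hxy : x = y
  · subst hxy
    rw [Quiver.Path.eq_nil_of_length_zero p (hac x p), hn, map_zero]
  · rw [map_pathClass_of_isNormalized hδ hn, vertexCoeff_mul, vertexCoeff_mul]
    by_cases hxz : x = z
    · rw [vertexCoeff_vertexClass_of_ne hI fun h => hxy (hxz.trans h.symm), mul_zero]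
    · rw [vertexCoeff_vertexClass_of_ne hI hxz, zero_mul, zero_mul]

/-- Modulo `J²` the derivation is a matrix on the arrows from `x` to `y`. Paths with other ends
cannot contribute because `e_u A e_v` is preserved; longer paths cannot because every Leibniz term
is a product of two factors without vertex components. -/
theorem arrowCoeff_map (hI : InArrowSquare I)
    (hac : ∀ (x : V) (p : Quiver.Path x x), p.length = 0)
    {δ : Module.End k (PathAlgebra k V ⧸ I)} (hδ : δ ∈ cocycles k (PathAlgebra k V ⧸ I))
    (hn : IsNormalized δ) {x y : V} [Fintype (x ⟶ y)] (β : x ⟶ y) (a : PathAlgebra k V ⧸ I) :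
    arrowCoeff hI β (δ a) =
      ∑ γ : x ⟶ y, arrowCoeff hI β (δ (arrowClass I γ)) * arrowCoeff hI γ a := by
  classical
  have key : arrowCoeff hI β ∘ₗ δ =
      ∑ γ : x ⟶ y, arrowCoeff hI β (δ (arrowClass I γ)) • arrowCoeff hI γ := by
    refine quotient_linearMap_ext fun u v p => ?_
    simp only [LinearMap.comp_apply, LinearMap.sum_apply, LinearMap.smul_apply, smul_eq_mul]
    by_cases huv : u ≠ x ∨ v ≠ y
    · rw [Finset.sum_eq_zero fun γ _ => by rw [arrowCoeff_pathClass_of_ne hI γ p huv, mul_zero],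
        map_pathClass_of_isNormalized hδ hn, arrowCoeff_mul, vertexCoeff_mul,
        arrowCoeff_vertexClass, mul_zero, zero_add, arrowCoeff_mul, arrowCoeff_vertexClass,
        zero_mul, add_zero]
      rcases huv with h | h
      · rw [vertexCoeff_vertexClass_of_ne hI h, zero_mul, zero_mul]
      · rw [vertexCoeff_vertexClass_of_ne hI h, mul_zero]
    · push Not at huv
      obtain ⟨rfl, rfl⟩ := huv
      cases p with
      | nil => simp [hn u, arrowCoeff_vertexClass]
      | cons q α =>
        cases q with
        | nil =>
          change arrowCoeff hI β (δ (arrowClass I α)) =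
            ∑ γ, arrowCoeff hI β (δ (arrowClass I γ)) * arrowCoeff hI γ (arrowClass I α)
          simp [arrowCoeff_arrowClass]
        | cons r e =>
          rw [Finset.sum_eq_zero fun γ _ => by
            rw [arrowCoeff_pathClass_of_length hI γ _ (by simp), mul_zero]]
          rw [pathClass_cons, map_mul_of_mem hδ, map_add, arrowCoeff_mul, arrowCoeff_mul,
            vertexCoeff_map_pathClass hI hac hδ hn, vertexCoeff_map_pathClass hI hac hδ hn,
            vertexCoeff_pathClass_of_pos hI _ (r.cons e) (by simp),
            vertexCoeff_pathClass_of_pos hI _ α.toPath (by simp)]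
          simp
  simpa using LinearMap.congr_fun key a

/-- The trace of the action of a derivation on the arrows between two vertices vanishes on
commutators. -/
theorem sum_arrowCoeff_lie (hI : InArrowSquare I)
    (hac : ∀ (x : V) (p : Quiver.Path x x), p.length = 0)
    {δ η : Module.End k (PathAlgebra k V ⧸ I)} (hδ : δ ∈ cocycles k (PathAlgebra k V ⧸ I))
    (hη : η ∈ cocycles k (PathAlgebra k V ⧸ I)) (hnδ : IsNormalized δ) (hnη : IsNormalized η)
    {x y : V} [Fintype (x ⟶ y)] :
    ∑ α : x ⟶ y, arrowCoeff hI α (⁅δ, η⁆ (arrowClass I α)) = 0 := by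
  have h : ∀ α : x ⟶ y, arrowCoeff hI α (⁅δ, η⁆ (arrowClass I α)) =
      ∑ γ : x ⟶ y, arrowCoeff hI α (δ (arrowClass I γ)) * arrowCoeff hI γ (η (arrowClass I α)) -
      ∑ γ : x ⟶ y, arrowCoeff hI α (η (arrowClass I γ)) * arrowCoeff hI γ (δ (arrowClass I α)) := by
    intro α
    rw [← arrowCoeff_map hI hac hδ hnδ, ← arrowCoeff_map hI hac hη hnη, ← map_sub]
    rfl
  rw [Finset.sum_congr rfl fun α _ => h α, Finset.sum_sub_distrib, sub_eq_zero, Finset.sum_comm]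
  exact Finset.sum_congr rfl fun γ _ => Finset.sum_congr rfl fun α _ => mul_comm _ _

/-- The diagonal coefficient of a linear endomorphism of `kQ / I` at an arrow. -/
def arrowTrace (hI : InArrowSquare I) {x y : V} (α : x ⟶ y) :
    Module.End k (PathAlgebra k V ⧸ I) →ₗ[k] k :=
  arrowCoeff hI α ∘ₗ LinearMap.applyₗ (arrowClass I α)

theorem arrowTrace_apply (hI : InArrowSquare I) {x y : V} (α : x ⟶ y)
    (δ : Module.End k (PathAlgebra k V ⧸ I)) :
    arrowTrace hI α δ = arrowCoeff hI α (δ (arrowClass I α)) := rfl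

theorem arrowCoeff_d0 (hI : InArrowSquare I) {x y : V} [DecidableEq (x ⟶ y)] (α β : x ⟶ y)
    (z : PathAlgebra k V ⧸ I) :
    arrowCoeff hI β (d0 k (PathAlgebra k V ⧸ I) z (arrowClass I α)) =
      if β = α then vertexCoeff hI y z - vertexCoeff hI x z else 0 := by
  rw [d0_apply, map_sub, arrowCoeff_mul, arrowCoeff_mul, arrowCoeff_arrowClass,
    vertexCoeff_pathClass_of_pos hI x α.toPath (by simp),
    vertexCoeff_pathClass_of_pos hI y α.toPath (by simp)]
  split_ifs <;> simp

theorem arrowTrace_d0 (hI : InArrowSquare I) {x y : V} (α : x ⟶ y) (z : PathAlgebra k V ⧸ I) :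
    arrowTrace hI α (d0 k (PathAlgebra k V ⧸ I) z) = vertexCoeff hI y z - vertexCoeff hI x z := by
  classical
  rw [arrowTrace_apply, arrowCoeff_d0, if_pos rfl]

theorem arrowTrace_lie_of_subsingleton (hI : InArrowSquare I)
    (hac : ∀ (x : V) (p : Quiver.Path x x), p.length = 0)
    {δ η : Module.End k (PathAlgebra k V ⧸ I)} (hδ : δ ∈ cocycles k (PathAlgebra k V ⧸ I))
    (hη : η ∈ cocycles k (PathAlgebra k V ⧸ I)) (hnδ : IsNormalized δ) (hnη : IsNormalized η)
    {x y : V} [Subsingleton (x ⟶ y)] (α : x ⟶ y) : arrowTrace hI α ⁅δ, η⁆ = 0 := by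
  have := Fintype.ofSubsingleton α
  rw [← sum_arrowCoeff_lie hI hac hδ hη hnδ hnη (x := x) (y := y), Fintype.sum_subsingleton _ α,
    arrowTrace_apply]

/-- The sum of the diagonal coefficients of a linear endomorphism of `kQ / I` along a path. -/
def pathTrace (hI : InArrowSquare I) {x : V} :
    ∀ {y : V}, Quiver.Path x y → (Module.End k (PathAlgebra k V ⧸ I) →ₗ[k] k)
  | _, .nil => 0
  | _, .cons p α => pathTrace hI p + arrowTrace hI α

/-- The contributions of the successive arrows telescope. -/
theorem pathTrace_d0 (hI : InArrowSquare I) {x y : V} (p : Quiver.Path x y)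
    (z : PathAlgebra k V ⧸ I) :
    pathTrace hI p (d0 k (PathAlgebra k V ⧸ I) z) = vertexCoeff hI y z - vertexCoeff hI x z := by
  induction p with
  | nil => simp [pathTrace]
  | cons p α ih => rw [pathTrace, LinearMap.add_apply, ih, arrowTrace_d0]; ring

/-! ### The derivations given by matrices on the arrows from the source to the sink -/

variable {s t : V}

/-- Only `e_s` can precede `β`, since no path of positive length ends at a source. -/
theorem mul_arrowClass_of_source (hI : InArrowSquare I) (hs : ∀ y : V, IsEmpty (y ⟶ s))
    (β : s ⟶ t) (a : PathAlgebra k V ⧸ I) :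
    a * arrowClass I β = vertexCoeff hI s a • arrowClass I β := by
  have key : LinearMap.mulRight k (arrowClass I β) =
      (vertexCoeff hI s).smulRight (arrowClass I β) := by
    refine quotient_linearMap_ext fun x y p => ?_
    rw [LinearMap.mulRight_apply, LinearMap.smulRight_apply]
    cases p with
    | nil =>
      by_cases hx : x = s
      · subst hx
        rw [vertexClass_mul_pathClass, vertexCoeff_vertexClass_self, one_smul]
      · rw [pathClass_mul_of_ne _ _ hx, vertexCoeff_vertexClass_of_ne hI hx, zero_smul]
    | cons p e =>
      rw [vertexCoeff_pathClass_of_pos hI s (p.cons e) (by simp), zero_smul,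
        pathClass_mul_of_ne]
      rintro rfl
      exact (hs _).false e
  exact LinearMap.congr_fun key a

theorem arrowClass_mul_of_sink (hI : InArrowSquare I) (ht : ∀ y : V, IsEmpty (t ⟶ y))
    (β : s ⟶ t) (a : PathAlgebra k V ⧸ I) :
    arrowClass I β * a = vertexCoeff hI t a • arrowClass I β := by
  have key : LinearMap.mulLeft k (arrowClass I β) =
      (vertexCoeff hI t).smulRight (arrowClass I β) := by
    refine quotient_linearMap_ext fun x y p => ?_
    rw [LinearMap.mulLeft_apply, LinearMap.smulRight_apply]
    by_cases hp : p.length = 0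
    · obtain rfl := p.eq_of_length_zero hp
      obtain rfl := p.eq_nil_of_length_zero hp
      by_cases hx : t = x
      · subst hx
        rw [pathClass_mul_vertexClass, vertexCoeff_vertexClass_self, one_smul]
      · rw [pathClass_mul_of_ne _ _ hx, vertexCoeff_vertexClass_of_ne hI (Ne.symm hx), zero_smul]
    · rw [vertexCoeff_pathClass_of_pos hI t p (by omega), zero_smul, pathClass_mul_of_ne]
      rintro rfl
      obtain ⟨c, e, -⟩ := (Quiver.Path.length_ne_zero_iff_eq_comp p).1 hp
      exact (ht c).false e
  exact LinearMap.congr_fun key a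

variable [Fintype (s ⟶ t)]

/-- The endomorphism of `kQ / I` given by a matrix on the arrows from `s` to `t`; it kills all other
paths. -/
def arrowEnd (hI : InArrowSquare I) :
    Matrix (s ⟶ t) (s ⟶ t) k →ₗ[k] Module.End k (PathAlgebra k V ⧸ I) where
  toFun T := ∑ α : s ⟶ t, ∑ β : s ⟶ t, T β α • (arrowCoeff hI α).smulRight (arrowClass I β)
  map_add' T S := by simp only [Matrix.add_apply, add_smul, Finset.sum_add_distrib]
  map_smul' c T := by
    simp only [Matrix.smul_apply, smul_eq_mul, mul_smul, Finset.smul_sum, RingHom.id_apply]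

theorem arrowEnd_apply (hI : InArrowSquare I) (T : Matrix (s ⟶ t) (s ⟶ t) k)
    (a : PathAlgebra k V ⧸ I) :
    arrowEnd hI T a = ∑ α : s ⟶ t, ∑ β : s ⟶ t, (T β α * arrowCoeff hI α a) • arrowClass I β := by
  simp [arrowEnd, LinearMap.sum_apply, mul_smul]

/-- On the span of the arrows from `s` to `t` the algebra acts from both sides through the vertex
coefficients at `s` and `t`, so the Leibniz rule is `arrowCoeff_mul`. -/
theorem arrowEnd_mem_cocycles (hI : InArrowSquare I) (hs : ∀ y : V, IsEmpty (y ⟶ s))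
    (ht : ∀ y : V, IsEmpty (t ⟶ y)) (T : Matrix (s ⟶ t) (s ⟶ t) k) :
    arrowEnd hI T ∈ cocycles k (PathAlgebra k V ⧸ I) := by
  refine mem_cocycles fun a b => ?_
  simp only [arrowEnd_apply, Finset.mul_sum, Finset.sum_mul, ← Finset.sum_add_distrib]
  refine Finset.sum_congr rfl fun α _ => Finset.sum_congr rfl fun β _ => ?_
  rw [mul_smul_comm, smul_mul_assoc, mul_arrowClass_of_source hI hs, arrowClass_mul_of_sink hI ht,
    smul_smul, smul_smul, ← add_smul, arrowCoeff_mul]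
  congr 1
  ring

theorem isNormalized_arrowEnd (hI : InArrowSquare I) (T : Matrix (s ⟶ t) (s ⟶ t) k) :
    IsNormalized (arrowEnd hI T) := fun x => by
  simp [arrowEnd_apply, arrowCoeff_vertexClass]

theorem arrowEnd_arrowClass (hI : InArrowSquare I) (T : Matrix (s ⟶ t) (s ⟶ t) k) (γ : s ⟶ t) :
    arrowEnd hI T (arrowClass I γ) = ∑ β : s ⟶ t, T β γ • arrowClass I β := by
  classical
  rw [arrowEnd_apply, Finset.sum_comm]
  refine Finset.sum_congr rfl fun β _ => ?_
  rw [← Finset.sum_smul]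
  simp [arrowCoeff_arrowClass]

theorem arrowCoeff_arrowEnd (hI : InArrowSquare I) (T : Matrix (s ⟶ t) (s ⟶ t) k) (γ : s ⟶ t)
    (a : PathAlgebra k V ⧸ I) :
    arrowCoeff hI γ (arrowEnd hI T a) = ∑ α : s ⟶ t, T γ α * arrowCoeff hI α a := by
  classical
  simp [arrowEnd_apply, map_sum, arrowCoeff_arrowClass]

theorem arrowEnd_mul (hI : InArrowSquare I) (T S : Matrix (s ⟶ t) (s ⟶ t) k) :
    arrowEnd hI (T * S) = arrowEnd hI T * arrowEnd hI S := by
  refine LinearMap.ext fun a => ?_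
  rw [Module.End.mul_apply, arrowEnd_apply, arrowEnd_apply, Finset.sum_comm]
  conv_rhs => rw [Finset.sum_comm]
  refine Finset.sum_congr rfl fun β _ => ?_
  rw [← Finset.sum_smul, ← Finset.sum_smul]
  congr 1
  simp only [arrowCoeff_arrowEnd, Matrix.mul_apply, Finset.sum_mul, Finset.mul_sum]
  rw [Finset.sum_comm]
  exact Finset.sum_congr rfl fun γ _ => Finset.sum_congr rfl fun α _ => mul_assoc _ _ _

variable [DecidableEq (s ⟶ t)]

theorem arrowEnd_lie (hI : InArrowSquare I) (T S : Matrix (s ⟶ t) (s ⟶ t) k) :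
    arrowEnd hI ⁅T, S⁆ = ⁅arrowEnd hI T, arrowEnd hI S⁆ := by
  rw [LieRing.of_associative_ring_bracket, LieRing.of_associative_ring_bracket, map_sub,
    arrowEnd_mul, arrowEnd_mul]

/-- The Lie algebra morphism from matrices on the arrows from `s` to `t` to the derivations of
`kQ / I`. -/
def arrowDerivation (hI : InArrowSquare I) (hs : ∀ y : V, IsEmpty (y ⟶ s))
    (ht : ∀ y : V, IsEmpty (t ⟶ y)) :
    Matrix (s ⟶ t) (s ⟶ t) k →ₗ⁅k⁆ cocycles k (PathAlgebra k V ⧸ I) where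
  toLinearMap := (arrowEnd hI).codRestrict (cocycles k (PathAlgebra k V ⧸ I)).toSubmodule
    fun T => arrowEnd_mem_cocycles hI hs ht T
  map_lie' := Subtype.ext (arrowEnd_lie hI _ _)

theorem coe_arrowDerivation (hI : InArrowSquare I) (hs : ∀ y : V, IsEmpty (y ⟶ s))
    (ht : ∀ y : V, IsEmpty (t ⟶ y)) (T : Matrix (s ⟶ t) (s ⟶ t) k) :
    (arrowDerivation hI hs ht T : Module.End k (PathAlgebra k V ⧸ I)) = arrowEnd hI T := rfl

end Derivations

section Toupie

open Hochschild

attribute [local instance 100] LieRing.ofAssociativeRing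

/-! ### Paths in toupie quivers -/

namespace IsToupie

variable {V : Type u} [Quiver.{v} V] {s t : V}

theorem isEmpty_hom_source (hQ : IsToupie s t) (y : V) : IsEmpty (y ⟶ s) :=
  (hQ.isSource_iff s).2 rfl y

theorem isEmpty_sink_hom (hQ : IsToupie s t) (y : V) : IsEmpty (t ⟶ y) :=
  (hQ.isSink_iff t).2 rfl y

theorem target_ne_source (hQ : IsToupie s t) {x y : V} (α : x ⟶ y) : y ≠ s := by
  rintro rfl
  exact (hQ.isEmpty_hom_source x).false α

theorem source_ne_sink (hQ : IsToupie s t) {x y : V} (α : x ⟶ y) : x ≠ t := by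
  rintro rfl
  exact (hQ.isEmpty_sink_hom y).false α

/-- An arrow that does not go from the source to the sink is the only path between its ends. -/
theorem path_eq_toPath (hQ : IsToupie s t) {x y : V} (h : x ≠ s ∨ y ≠ t) (α : x ⟶ y)
    (p : Quiver.Path x y) : p = α.toPath := by
  have hp : p.length ≠ 0 := fun h0 => by
    obtain rfl := p.eq_of_length_zero h0
    exact absurd (hQ.length_eq_zero x α.toPath) (by simp)
  -- An inner end has a unique arrow on its other side. That arrow must be both `α` and the first
  -- (or last) arrow of `p`; the rest of `p` is a closed path, hence trivial.
  rcases h with h | h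
  · obtain ⟨hu⟩ := hQ.unique_out x h (hQ.source_ne_sink α)
    obtain ⟨c, e, q, rfl, -⟩ := (Quiver.Path.length_ne_zero_iff_eq_comp p).1 hp
    obtain ⟨rfl, he⟩ := Sigma.mk.inj_iff.1
      (Subsingleton.elim (⟨c, e⟩ : Σ y : V, (x ⟶ y)) ⟨y, α⟩)
    rw [eq_of_heq he, Quiver.Path.eq_nil_of_length_zero q (hQ.length_eq_zero _ q)]
    rfl
  · obtain ⟨hu⟩ := hQ.unique_in y (hQ.target_ne_source α) h
    cases p with
    | nil => exact absurd rfl hp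
    | @cons c _ q e =>
      obtain ⟨rfl, he⟩ := Sigma.mk.inj_iff.1
        (Subsingleton.elim (⟨c, e⟩ : Σ x : V, (x ⟶ y)) ⟨x, α⟩)
      rw [eq_of_heq he, Quiver.Path.eq_nil_of_length_zero q (hQ.length_eq_zero _ q)]
      rfl

theorem subsingleton_hom (hQ : IsToupie s t) {x y : V} (h : x ≠ s ∨ y ≠ t) :
    Subsingleton (x ⟶ y) :=
  ⟨fun α β => eq_of_heq (Quiver.Path.hom_heq_of_cons_eq_cons (hQ.path_eq_toPath h β α.toPath))⟩

/-- Without oriented cycles, being joined by a path of positive length is a strict order on a finite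
set. -/
theorem wellFounded_path [Finite V] (hac : ∀ (x : V) (p : Quiver.Path x x), p.length = 0) :
    WellFounded fun x y : V => ∃ p : Quiver.Path x y, 0 < p.length := by
  have : IsTrans V fun x y : V => ∃ p : Quiver.Path x y, 0 < p.length :=
    ⟨fun _ _ _ ⟨p, hp⟩ ⟨q, _⟩ => ⟨p.comp q, by rw [Quiver.Path.length_comp]; omega⟩⟩
  have : Std.Irrefl fun x y : V => ∃ p : Quiver.Path x y, 0 < p.length :=
    ⟨fun x ⟨p, hp⟩ => hp.ne' (hac x p)⟩
  exact Finite.wellFounded_of_trans_of_irrefl _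

theorem wellFounded_path_flip [Finite V] (hac : ∀ (x : V) (p : Quiver.Path x x), p.length = 0) :
    WellFounded fun x y : V => ∃ p : Quiver.Path y x, 0 < p.length := by
  have : IsTrans V fun x y : V => ∃ p : Quiver.Path y x, 0 < p.length :=
    ⟨fun _ _ _ ⟨p, hp⟩ ⟨q, _⟩ => ⟨q.comp p, by rw [Quiver.Path.length_comp]; omega⟩⟩
  have : Std.Irrefl fun x y : V => ∃ p : Quiver.Path y x, 0 < p.length :=
    ⟨fun x ⟨p, hp⟩ => hp.ne' (hac x p)⟩
  exact Finite.wellFounded_of_trans_of_irrefl _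

theorem nonempty_path_from_source [Finite V] (hQ : IsToupie s t) (x : V) :
    Nonempty (Quiver.Path s x) := by
  induction x using (wellFounded_path hQ.length_eq_zero).induction with
  | _ x ih =>
    by_cases hx : x = s
    · subst hx; exact ⟨.nil⟩
    · obtain ⟨y, ⟨α⟩⟩ : ∃ y, Nonempty (y ⟶ x) := by
        by_contra! H
        exact hx ((hQ.isSource_iff x).1 H)
      obtain ⟨p⟩ := ih y ⟨α.toPath, by simp⟩
      exact ⟨p.cons α⟩

theorem nonempty_path_to_sink [Finite V] (hQ : IsToupie s t) (x : V) :
    Nonempty (Quiver.Path x t) := by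
  induction x using (wellFounded_path_flip hQ.length_eq_zero).induction with
  | _ x ih =>
    by_cases hx : x = t
    · subst hx; exact ⟨.nil⟩
    · obtain ⟨y, ⟨α⟩⟩ : ∃ y, Nonempty (x ⟶ y) := by
        by_contra! H
        exact hx ((hQ.isSink_iff x).1 H)
      obtain ⟨p⟩ := ih y ⟨α.toPath, by simp⟩
      exact ⟨α.toPath.comp p⟩

theorem finite_path [Finite V] [∀ x y : V, Finite (x ⟶ y)]
    (hac : ∀ (x : V) (p : Quiver.Path x x), p.length = 0) (x y : V) :
    Finite (Quiver.Path x y) := by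
  induction y using (wellFounded_path hac).induction with
  | _ y ih =>
    have hfin : ∀ z : V, Finite (Quiver.Path x z × (z ⟶ y)) := fun z => by
      by_cases hz : Nonempty (z ⟶ y)
      · obtain ⟨α⟩ := hz
        have := ih z ⟨α.toPath, by simp⟩
        infer_instance
      · rw [not_nonempty_iff] at hz
        infer_instance
    let f : Quiver.Path x y → Option (Σ z : V, Quiver.Path x z × (z ⟶ y)) := fun p =>
      match p with
      | .nil => none
      | .cons q α => some ⟨_, q, α⟩
    refine Finite.of_injective f fun p q hpq => ?_
    cases p with
    | nil => exact (Quiver.Path.eq_nil_of_length_zero q (hac _ q)).symm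
    | cons p α =>
      cases q with
      | nil => cases hpq
      | cons q β =>
        cases hpq
        rfl

/-- If no path from the source to the sink has length two, then all arrows go from the source to the
sink. -/
theorem eq_source_and_eq_sink [Finite V] (hQ : IsToupie s t)
    (hl : ∀ p : Quiver.Path s t, p.length < 2) {x y : V} (α : x ⟶ y) : x = s ∧ y = t := by
  obtain ⟨p⟩ := hQ.nonempty_path_from_source x
  obtain ⟨q⟩ := hQ.nonempty_path_to_sink y
  have h := hl ((p.cons α).comp q)
  rw [Quiver.Path.length_comp, Quiver.Path.length_cons] at h
  exact ⟨(p.eq_of_length_zero (by omega)).symm, q.eq_of_length_zero (by omega)⟩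

end IsToupie

/-! ### The abelian case and the obstruction to semisimplicity -/

variable {k : Type w} [Field k] {V : Type u} [Quiver.{v} V] [Fintype V]
  {I : Ideal (PathAlgebra k V)} [I.IsTwoSided] {s t : V}

/-- If all paths from `x` to `y` are arrows, then the arrows span `e_x A e_y`. -/
theorem vertexClass_mul_mul_vertexClass (hI : InArrowSquare I) {x y : V} [Fintype (x ⟶ y)]
    (h : ∀ p : Quiver.Path x y, p.length = 1) (a : PathAlgebra k V ⧸ I) :
    vertexClass I x * a * vertexClass I y =
      ∑ γ : x ⟶ y, arrowCoeff hI γ a • arrowClass I γ := by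
  classical
  have key : LinearMap.mulRight k (vertexClass I y) ∘ₗ LinearMap.mulLeft k (vertexClass I x) =
      ∑ γ : x ⟶ y, (arrowCoeff hI γ).smulRight (arrowClass I γ) := by
    refine quotient_linearMap_ext fun u v p => ?_
    simp only [LinearMap.comp_apply, LinearMap.mulRight_apply, LinearMap.mulLeft_apply,
      LinearMap.sum_apply, LinearMap.smulRight_apply]
    by_cases huv : u ≠ x ∨ v ≠ y
    · rw [Finset.sum_eq_zero fun γ _ => by rw [arrowCoeff_pathClass_of_ne hI γ p huv, zero_smul]]
      rcases huv with hu | hv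
      · rw [pathClass_mul_of_ne _ _ hu.symm, zero_mul]
      · rw [mul_assoc, pathClass_mul_of_ne _ _ hv, mul_zero]
    · push Not at huv
      obtain ⟨rfl, rfl⟩ := huv
      rw [vertexClass_mul_pathClass, pathClass_mul_vertexClass]
      have hp := h p
      cases p with
      | nil => simp at hp
      | cons q α =>
        cases q with
        | nil =>
          change arrowClass I α = ∑ γ, arrowCoeff hI γ (arrowClass I α) • arrowClass I γ
          simp [arrowCoeff_arrowClass]
        | cons => simp at hp
  simpa using LinearMap.congr_fun key a

theorem map_arrowClass_of_isNormalized (hI : InArrowSquare I)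
    {δ : Module.End k (PathAlgebra k V ⧸ I)} (hδ : δ ∈ cocycles k (PathAlgebra k V ⧸ I))
    (hn : IsNormalized δ) {x y : V} [Fintype (x ⟶ y)]
    (h : ∀ p : Quiver.Path x y, p.length = 1) (α : x ⟶ y) :
    δ (arrowClass I α) = ∑ γ : x ⟶ y, arrowCoeff hI γ (δ (arrowClass I α)) • arrowClass I γ := by
  rw [← vertexClass_mul_mul_vertexClass hI h, ← map_pathClass_of_isNormalized hδ hn]

/-- If no arrow goes from the source to the sink of a toupie quiver, then `HH¹` is abelian. -/
theorem isLieAbelian_HH1 (hQ : IsToupie s t) (hI : InArrowSquare I) [IsEmpty (s ⟶ t)] :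
    IsLieAbelian (HH1 k (PathAlgebra k V ⧸ I)) := by
  refine ⟨fun a b => ?_⟩
  obtain ⟨δ, hδ, rfl⟩ := exists_isNormalized_rep a
  obtain ⟨η, hη, rfl⟩ := exists_isNormalized_rep b
  suffices h : ⁅δ, η⁆ = 0 by
    rw [← LieSubmodule.Quotient.mk_bracket, h]; rfl
  -- Here `e_x A e_y` is spanned by `α` for every arrow, so normalized derivations are
  -- simultaneously diagonal on the arrows.
  have hscal : ∀ {ε : cocycles k (PathAlgebra k V ⧸ I)}, IsNormalized ε.1 → ∀ (x y : V)
      (α : x ⟶ y), ε.1 (arrowClass I α) =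
        arrowCoeff hI α (ε.1 (arrowClass I α)) • arrowClass I α := by
    intro ε hε x y α
    have hne : x ≠ s ∨ y ≠ t := by
      by_contra! H
      obtain ⟨rfl, rfl⟩ := H
      exact isEmptyElim α
    have := hQ.subsingleton_hom hne
    have := Fintype.ofSubsingleton α
    refine (map_arrowClass_of_isNormalized hI ε.2 hε
      (fun p => by rw [hQ.path_eq_toPath hne α p]; simp) α).trans ?_
    rw [Fintype.sum_subsingleton _ α]
  refine Subtype.ext (cocycle_ext ⁅δ, η⁆.2 (zero_mem _) (fun x => ?_) fun x y α => ?_)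
  · change δ.1 (η.1 _) - η.1 (δ.1 _) = 0
    rw [hδ, hη, map_zero, map_zero, sub_zero]
  · change δ.1 (η.1 _) - η.1 (δ.1 _) = 0
    obtain ⟨c, hc⟩ : ∃ c : k, δ.1 (arrowClass I α) = c • arrowClass I α := ⟨_, hscal hδ x y α⟩
    obtain ⟨d, hd⟩ : ∃ d : k, η.1 (arrowClass I α) = d • arrowClass I α := ⟨_, hscal hη x y α⟩
    rw [hc, hd, map_smul, map_smul, hc, hd, smul_comm, sub_self]

/-- No arrow of a branch of length at least two goes from `s` to `t`: all but the last miss `t`, and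
the last does not start at `s`. -/
theorem pathTrace_eq_zero (hQ : IsToupie s t) (hI : InArrowSquare I)
    {F : Module.End k (PathAlgebra k V ⧸ I)}
    (hF : ∀ {x y : V} (α : x ⟶ y), x ≠ s ∨ y ≠ t → arrowTrace hI α F = 0)
    (p : Quiver.Path s t) (hp : 2 ≤ p.length) : pathTrace hI p F = 0 := by
  have aux : ∀ {x : V} (q : Quiver.Path s x), x ≠ t → pathTrace hI q F = 0 := by
    intro x q
    induction q with
    | nil => intro _; rfl
    | cons q α ih =>
      intro hx
      rw [pathTrace, LinearMap.add_apply, ih (hQ.source_ne_sink α), hF α (Or.inr hx), add_zero]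
  cases p with
  | nil => simp at hp
  | cons q α =>
    rw [pathTrace, LinearMap.add_apply, aux q (hQ.source_ne_sink α), hF α (Or.inl ?_), add_zero]
    cases q with
    | nil => simp at hp
    | cons q β => exact hQ.target_ne_source β

/-- If a toupie quiver has an arrow from the source to the sink and a path of length at least two
from the source to the sink, then `HH¹` is not semisimple. -/
theorem not_isSemisimple_HH1 [CharZero k] (hQ : IsToupie s t) (hI : InArrowSquare I)
    [Finite (s ⟶ t)] [Nonempty (s ⟶ t)] (p : Quiver.Path s t) (hp : 2 ≤ p.length) :
    ¬ LieAlgebra.IsSemisimple k (HH1 k (PathAlgebra k V ⧸ I)) := by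
  classical
  intro hss
  have := Fintype.ofFinite (s ⟶ t)
  -- The factor `a` balances the two terms on inner derivations: each of the `a` arrows contributes
  -- `z_t - z_s`, and so does the whole path `p`.
  let χ : Module.End k (PathAlgebra k V ⧸ I) →ₗ[k] k :=
    ∑ α : s ⟶ t, arrowTrace hI α - (Fintype.card (s ⟶ t) : k) • pathTrace hI p
  have hχ : ∀ F, χ F = ∑ α : s ⟶ t, arrowTrace hI α F -
      (Fintype.card (s ⟶ t) : k) * pathTrace hI p F := fun F => by
    simp [χ, LinearMap.sum_apply]
  have hχ0 : ∀ z, χ (d0 k _ z) = 0 := fun z => by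
    rw [hχ, pathTrace_d0, Finset.sum_congr rfl fun α _ => arrowTrace_d0 hI α z, Finset.sum_const,
      nsmul_eq_mul, Finset.card_univ, sub_self]
  let φ : HH1 k (PathAlgebra k V ⧸ I) →ₗ[k] k :=
    (coboundaries k (PathAlgebra k V ⧸ I)).toSubmodule.liftQ
      (χ ∘ₗ (cocycles k (PathAlgebra k V ⧸ I)).toSubmodule.subtype) (by
        rintro δ ⟨z, hz⟩
        change χ δ.1 = 0
        rw [← hχ0 z]
        exact congrArg χ hz.symm)
  have hφ : ∀ δ, φ (LieSubmodule.Quotient.mk δ) = χ δ.1 := fun δ => rfl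
  have hφ0 : φ = 0 := by
    refine LieAlgebra.IsSemisimple.eq_zero_of_map_lie φ fun a b => ?_
    obtain ⟨δ, hδ, rfl⟩ := exists_isNormalized_rep a
    obtain ⟨η, hη, rfl⟩ := exists_isNormalized_rep b
    rw [← LieSubmodule.Quotient.mk_bracket, hφ, hχ, pathTrace_eq_zero hQ hI _ p hp, mul_zero,
      sub_zero]
    · exact sum_arrowCoeff_lie hI hQ.length_eq_zero δ.2 η.2 hδ hη
    · intro x y α h
      have := hQ.subsingleton_hom h
      exact arrowTrace_lie_of_subsingleton hI hQ.length_eq_zero δ.2 η.2 hδ hη α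
  -- The identity matrix gives a derivation that kills every arrow of `p`, so only the trace `a`
  -- remains, nonzero in characteristic zero.
  have h1 : φ (LieSubmodule.Quotient.mk
      (arrowDerivation hI hQ.isEmpty_hom_source hQ.isEmpty_sink_hom 1)) =
        Fintype.card (s ⟶ t) := by
    rw [hφ, hχ, pathTrace_eq_zero hQ hI _ p hp, mul_zero, sub_zero]
    · simp only [coe_arrowDerivation, arrowTrace_apply, arrowCoeff_arrowEnd, arrowCoeff_arrowClass,
        Matrix.one_apply]
      simp
    · intro x y α h
      rw [coe_arrowDerivation, arrowTrace_apply, arrowEnd_apply]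
      simp only [arrowCoeff_pathClass_of_ne hI _ α.toPath h, mul_zero, zero_smul,
        Finset.sum_const_zero, map_zero]
  rw [hφ0, LinearMap.zero_apply] at h1
  exact Fintype.card_ne_zero (α := s ⟶ t) (by exact_mod_cast h1.symm)

/-! ### The corner space -/

theorem mem_cornerSpace {a : PathAlgebra k V ⧸ I} :
    a ∈ cornerSpace I s t ↔ ∃ b, vertexClass I s * b * vertexClass I t = a := by
  simp only [cornerSpace, LinearMap.mem_range, LinearMap.comp_apply, LinearMap.mulLeft_apply,
    LinearMap.mulRight_apply, mul_assoc]

theorem pathClass_mem_cornerSpace (p : Quiver.Path s t) : pathClass I p ∈ cornerSpace I s t :=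
  mem_cornerSpace.2 ⟨pathClass I p, by rw [vertexClass_mul_pathClass, pathClass_mul_vertexClass]⟩

theorem linearIndependent_arrowClass (hI : InArrowSquare I) {x y : V} [Finite (x ⟶ y)] :
    LinearIndependent k fun α : x ⟶ y => arrowClass I α := by
  classical
  have := Fintype.ofFinite (x ⟶ y)
  rw [Fintype.linearIndependent_iff]
  intro g hg α
  simpa [map_sum, arrowCoeff_arrowClass] using congrArg (arrowCoeff hI α) hg

theorem finrank_span_arrowClass (hI : InArrowSquare I) [Finite (s ⟶ t)] :
    Module.finrank k (Submodule.span k (Set.range fun α : s ⟶ t => arrowClass I α)) =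
      numArrows s t := by
  have := Fintype.ofFinite (s ⟶ t)
  rw [finrank_span_eq_card (linearIndependent_arrowClass hI), numArrows, Nat.card_eq_fintype_card]

theorem span_arrowClass_le_cornerSpace :
    Submodule.span k (Set.range fun α : s ⟶ t => arrowClass I α) ≤ cornerSpace I s t :=
  Submodule.span_le.2 <| Set.range_subset_iff.2 fun α => pathClass_mem_cornerSpace α.toPath

theorem numArrows_eq_cornerDim (hI : InArrowSquare I) [Finite (s ⟶ t)]
    (h : ∀ p : Quiver.Path s t, p.length = 1) : numArrows s t = cornerDim I s t := by
  have := Fintype.ofFinite (s ⟶ t)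
  have heq : Submodule.span k (Set.range fun α : s ⟶ t => arrowClass I α) = cornerSpace I s t := ?_
  · rw [← finrank_span_arrowClass hI (I := I), cornerDim, heq]
  refine le_antisymm span_arrowClass_le_cornerSpace fun a ha => ?_
  obtain ⟨b, rfl⟩ := mem_cornerSpace.1 ha
  rw [vertexClass_mul_mul_vertexClass hI h]
  exact sum_mem fun γ _ => Submodule.smul_mem _ _ (Submodule.subset_span ⟨γ, rfl⟩)

/-- If the arrows from `s` to `t` span `e_s A e_t`, then all longer paths from `s` to `t` lie in
`I`. -/
theorem ofPath_mem_of_numArrows_eq (hI : InArrowSquare I) [Finite (s ⟶ t)] [Nonempty (s ⟶ t)]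
    (h : numArrows s t = cornerDim I s t) (p : Quiver.Path s t) (hp : 2 ≤ p.length) :
    (PathAlgebra.ofPath p : PathAlgebra k V) ∈ I := by
  classical
  have := Fintype.ofFinite (s ⟶ t)
  -- `finrank` is `0` in infinite dimension; since `a > 0`, its positivity shows that the corner
  -- space is finite-dimensional, so equal dimensions force the arrows to span it.
  have hpos : 0 < Module.finrank k (cornerSpace I s t) := by
    change 0 < cornerDim I s t
    rw [← h]; exact Nat.card_pos
  have := Module.finite_of_finrank_pos hpos
  have heq := Submodule.eq_of_le_of_finrank_eq
    (span_arrowClass_le_cornerSpace (I := I) (s := s) (t := t))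
    ((finrank_span_arrowClass hI).trans h)
  have hmem := pathClass_mem_cornerSpace (I := I) p
  rw [← heq, Submodule.mem_span_range_iff_exists_fun] at hmem
  obtain ⟨c, hc⟩ := hmem
  have hc0 : ∀ α, c α = 0 := fun α => by
    have := congrArg (arrowCoeff hI α) hc
    rw [arrowCoeff_pathClass_of_length hI α p (by omega)] at this
    simpa [map_sum, arrowCoeff_arrowClass] using this
  refine Ideal.Quotient.eq_zero_iff_mem.1 (hc.symm.trans ?_)
  simp [hc0]

theorem numArrows_eq_and_numMonomialBranches_eq_zero_iff (hQ : IsToupie s t)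
    [∀ x y : V, Finite (x ⟶ y)] (hI : InArrowSquare I) [Nonempty (s ⟶ t)] :
    (numArrows s t = cornerDim I s t ∧ numMonomialBranches I s t = 0) ↔
      ∀ p : Quiver.Path s t, p.length < 2 := by
  constructor
  · rintro ⟨ha, hm⟩ p
    by_contra! hp
    -- `Nat.card` is also `0` on infinite types, so finiteness of the set of branches is needed to
    -- conclude that none contains a monomial relation.
    have := IsToupie.finite_path hQ.length_eq_zero s t
    rw [numMonomialBranches, Finite.card_eq_zero_iff] at hm
    exact hm.false ⟨p, s, t, .nil, p, .nil, by simp, ofPath_mem_of_numArrows_eq hI ha p hp⟩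
  · intro hl
    refine ⟨numArrows_eq_cornerDim hI fun p => ?_, ?_⟩
    · have h0 : p.length ≠ 0 := fun h0 => by
        obtain ⟨α⟩ := ‹Nonempty (s ⟶ t)›
        exact hQ.source_ne_sink α (p.eq_of_length_zero h0)
      have := hl p
      omega
    · rw [numMonomialBranches, Nat.card_eq_zero]
      exact Or.inl ⟨fun p => absurd (two_le_length_of_containsMonomialRelation hI p.2)
        (by have := hl p.1; omega)⟩

/-! ### The isomorphism with the special linear Lie algebra -/

section Iso

variable [Fintype (s ⟶ t)] [DecidableEq (s ⟶ t)]

/-- The morphism from the special linear Lie algebra on the arrows from `s` to `t` to `HH¹`. -/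
def slToHH1 (hQ : IsToupie s t) (hI : InArrowSquare I) :
    LieAlgebra.SpecialLinear.sl (s ⟶ t) k →ₗ⁅k⁆ HH1 k (PathAlgebra k V ⧸ I) where
  toLinearMap := (LieSubmodule.Quotient.mk' (coboundaries k (PathAlgebra k V ⧸ I))).toLinearMap ∘ₗ
    (arrowDerivation hI hQ.isEmpty_hom_source hQ.isEmpty_sink_hom).toLinearMap ∘ₗ
    (LieAlgebra.SpecialLinear.sl (s ⟶ t) k).toSubmodule.subtype
  map_lie' {T S} := by
    change LieSubmodule.Quotient.mk (arrowDerivation hI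
      hQ.isEmpty_hom_source hQ.isEmpty_sink_hom ⁅T.1, S.1⁆) = _
    rw [LieHom.map_lie]
    exact LieSubmodule.Quotient.mk_bracket _ _ _

theorem slToHH1_apply (hQ : IsToupie s t) (hI : InArrowSquare I)
    (T : LieAlgebra.SpecialLinear.sl (s ⟶ t) k) :
    slToHH1 hQ hI T = LieSubmodule.Quotient.mk (N := coboundaries k (PathAlgebra k V ⧸ I))
      (arrowDerivation hI hQ.isEmpty_hom_source hQ.isEmpty_sink_hom T.1) := rfl

/-- If a matrix gives an inner derivation it is scalar, and a traceless scalar matrix is zero in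
characteristic zero. -/
theorem slToHH1_injective [CharZero k] (hQ : IsToupie s t) (hI : InArrowSquare I) :
    Function.Injective (slToHH1 (k := k) (I := I) hQ hI) := by
  refine (injective_iff_map_eq_zero _).2 fun T hT => ?_
  rw [slToHH1_apply, LieSubmodule.Quotient.mk_eq_zero'] at hT
  obtain ⟨z, hz⟩ := hT
  replace hz : d0 k _ z = arrowEnd hI T.1 := hz
  have hT : T.1 = (vertexCoeff hI t z - vertexCoeff hI s z) • (1 : Matrix (s ⟶ t) (s ⟶ t) k) := by
    ext β α
    have h := arrowCoeff_d0 hI α β z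
    rw [hz, arrowCoeff_arrowEnd] at h
    simpa [arrowCoeff_arrowClass, Matrix.one_apply] using h
  have htr : Matrix.trace T.1 = 0 := T.2
  rw [hT, Matrix.trace_smul, Matrix.trace_one, smul_eq_mul, mul_eq_zero] at htr
  apply Subtype.ext
  rcases htr with h | h
  · rw [hT, h, zero_smul]; rfl
  · have := Fintype.card_eq_zero_iff.1 (Nat.cast_eq_zero.1 h)
    exact Subsingleton.elim _ _

theorem slToHH1_surjective [CharZero k] [Nonempty (s ⟶ t)] (hQ : IsToupie s t)
    (hI : InArrowSquare I) (hl : ∀ p : Quiver.Path s t, p.length < 2) :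
    Function.Surjective (slToHH1 (k := k) (I := I) hQ hI) := by
  intro a
  obtain ⟨δ, hδ, rfl⟩ := exists_isNormalized_rep a
  obtain ⟨α₀⟩ := ‹Nonempty (s ⟶ t)›
  have hst : s ≠ t := hQ.source_ne_sink α₀
  have hl1 : ∀ p : Quiver.Path s t, p.length = 1 := fun p => by
    have h0 : p.length ≠ 0 := fun h0 => hst (p.eq_of_length_zero h0)
    have := hl p
    omega
  have hcard : (Fintype.card (s ⟶ t) : k) ≠ 0 :=
    Nat.cast_ne_zero.2 (Fintype.card_pos_iff.2 ⟨α₀⟩).ne'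
  let T : Matrix (s ⟶ t) (s ⟶ t) k := fun β α => arrowCoeff hI β (δ.1 (arrowClass I α))
  -- Subtracting the scalar `c` makes `T` traceless; the derivation scaling every arrow by `c` is
  -- inner, given by `c • e_t`.
  let c : k := Matrix.trace T / Fintype.card (s ⟶ t)
  have htr : T - c • (1 : Matrix (s ⟶ t) (s ⟶ t) k) ∈ LieAlgebra.SpecialLinear.sl (s ⟶ t) k := by
    change Matrix.trace _ = 0
    rw [Matrix.trace_sub, Matrix.trace_smul, Matrix.trace_one, smul_eq_mul,
      div_mul_cancel₀ _ hcard, sub_self]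
  refine ⟨⟨_, htr⟩, ?_⟩
  rw [slToHH1_apply]
  refine (Submodule.Quotient.eq _).2 ⟨-c • vertexClass I t, ?_⟩
  change d0 k _ _ = arrowEnd hI (T - c • (1 : Matrix (s ⟶ t) (s ⟶ t) k)) - δ.1
  refine cocycle_ext (d0_mem_cocycles _)
    (sub_mem (arrowEnd_mem_cocycles hI hQ.isEmpty_hom_source hQ.isEmpty_sink_hom _) δ.2)
    (fun x => ?_) fun x y α => ?_
  · rw [LinearMap.sub_apply, hδ, isNormalized_arrowEnd, sub_zero, d0_apply]
    by_cases hx : x = t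
    · subst hx
      rw [mul_smul_comm, smul_mul_assoc, sub_self]
    · rw [mul_smul_comm, smul_mul_assoc, pathClass_mul_of_ne _ _ hx,
        pathClass_mul_of_ne _ _ (Ne.symm hx), sub_self]
  · obtain ⟨rfl, rfl⟩ := hQ.eq_source_and_eq_sink hl α
    rw [LinearMap.sub_apply, arrowEnd_arrowClass, d0_apply, mul_smul_comm, smul_mul_assoc,
      pathClass_mul_vertexClass, pathClass_mul_of_ne _ _ hst.symm, smul_zero, sub_zero,
      map_arrowClass_of_isNormalized hI δ.2 hδ hl1 α, ← Finset.sum_sub_distrib]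
    have hT : ∀ β, (T - c • (1 : Matrix (x ⟶ y) (x ⟶ y) k)) β α • arrowClass I β -
        arrowCoeff hI β (δ.1 (arrowClass I α)) • arrowClass I β =
          if β = α then -c • arrowClass I β else 0 := fun β => by
      rw [← sub_smul, Matrix.sub_apply, Matrix.smul_apply, Matrix.one_apply]
      split_ifs <;> simp [T]
    rw [Finset.sum_congr rfl fun β _ => hT β]
    simp

end Iso

/-- The special linear Lie algebras on two index types of the same size are isomorphic. -/
def slReindex {m n : Type*} [Fintype m] [DecidableEq m] [Fintype n] [DecidableEq n] (e : m ≃ n) :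
    LieAlgebra.SpecialLinear.sl m k ≃ₗ⁅k⁆ LieAlgebra.SpecialLinear.sl n k :=
  (Matrix.reindexLieEquiv e).ofSubalgebras _ _ (by
    ext T
    have htr : ∀ M : Matrix m m k, Matrix.trace (Matrix.reindexLieEquiv e M) = Matrix.trace M :=
      fun M => Equiv.sum_comp e.symm fun i => M i i
    constructor
    · rintro ⟨M, hM, rfl⟩
      exact (htr M).trans hM
    · intro hT
      refine ⟨(Matrix.reindexLieEquiv e).symm T, ?_, LieEquiv.apply_symm_apply _ _⟩
      have h := htr ((Matrix.reindexLieEquiv e).symm T)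
      rw [LieEquiv.apply_symm_apply] at h
      exact h.symm.trans hT)

end Toupie

end

theorem mainTheorem8 {V : Type*} [Quiver V] [Fintype V] [∀ x y : V, Finite (x ⟶ y)]
    (s t : V) (hQ : IsToupie s t)
    (I : Ideal (PathAlgebra ℂ V)) [I.IsTwoSided] (hI : IsAdmissible I)
    (hna : ¬ IsLieAbelian (Hochschild.HH1 ℂ (PathAlgebra ℂ V ⧸ I))) :
    (LieAlgebra.IsSemisimple ℂ (Hochschild.HH1 ℂ (PathAlgebra ℂ V ⧸ I)) ↔
      numArrows s t = cornerDim I s t ∧ numMonomialBranches I s t = 0) ∧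
    (LieAlgebra.IsSemisimple ℂ (Hochschild.HH1 ℂ (PathAlgebra ℂ V ⧸ I)) →
      Nonempty (Hochschild.HH1 ℂ (PathAlgebra ℂ V ⧸ I) ≃ₗ⁅ℂ⁆
        LieAlgebra.SpecialLinear.sl (Fin (numArrows s t)) ℂ)) := by
  classical
  have hI2 : InArrowSquare I := hI.1
  have hne : Nonempty (s ⟶ t) := by
    by_contra! H
    exact hna (isLieAbelian_HH1 hQ hI2)
  have := Fintype.ofFinite (s ⟶ t)
  have hlong : LieAlgebra.IsSemisimple ℂ (Hochschild.HH1 ℂ (PathAlgebra ℂ V ⧸ I)) →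
      ∀ p : Quiver.Path s t, p.length < 2 := fun h p => by
    by_contra! hp
    exact not_isSemisimple_HH1 hQ hI2 p hp h
  have hiso : (∀ p : Quiver.Path s t, p.length < 2) →
      Nonempty (LieAlgebra.SpecialLinear.sl (s ⟶ t) ℂ ≃ₗ⁅ℂ⁆
        Hochschild.HH1 ℂ (PathAlgebra ℂ V ⧸ I)) := fun hl =>
    ⟨LieEquiv.ofBijective (slToHH1 hQ hI2)
      ⟨slToHH1_injective hQ hI2, slToHH1_surjective hQ hI2 hl⟩⟩
  rw [numArrows_eq_and_numMonomialBranches_eq_zero_iff hQ hI2]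
  refine ⟨⟨hlong, fun hl => ?_⟩, fun h => ?_⟩
  · obtain ⟨e⟩ := hiso hl
    have := LieAlgebra.SpecialLinear.isSimple (n := s ⟶ t) (k := ℂ)
      fun h => hna ((lie_abelian_iff_equiv_lie_abelian e).1 h)
    have := LieAlgebra.IsSimple.of_equiv e
    infer_instance
  · obtain ⟨e⟩ := hiso (hlong h)
    exact ⟨e.symm.trans (slReindex (Finite.equivFin (s ⟶ t)))⟩
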